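/- **Theorem (Cauchy–Pompeiu formula, II).** Let $\mathbb{O}$ be the octonions with standard basis $e_0=1,e_1,\dots,e_7$, where $e_i^2=-1$ for $i\ge1$, $e_ie_j=-e_je_i$ for distinct $i,j\ge1$, and $e_ie_j=e_k$ for the cyclic permutations $(i,j,k)$ of the triples $(1,2,3),(1,4,5),(2,4,6),(3,4,7),(5,3,6),(6,1,7),(7,2,5)$, and let $L_a x=ax$ denote left multiplication. Fix $p\in\{0,1,\dots,6\}$, identify $\mathbb{R}^{p+1}$ with $\operatorname{span}(e_0,\dots,e_p)$, and let $\mathbb{S}$ be the unit sphere of $\operatorname{span}(e_{p+1},\dots,e_7)$. For $\underline\omega\in\mathbb{S}$ identify $(\boldsymbol{x}_p,r)\in\mathbb{R}^{p+2}$ with $\boldsymbol{x}_p+r\underline\omega\in\mathbb{R}^{p+1}\oplus\underline\omega\mathbb{R}$, and for $V\subseteq\mathbb{O}$ put $V_{\underline\omega}=V\cap(\mathbb{R}^{p+1}\oplus\underline\omega\mathbb{R})\subseteq\mathbb{R}^{p+2}$. Let $D\subseteq\mathbb{R}^{p+2}$ be open and invariant under $(\boldsymbol{x}_p,r)\mapsto(\boldsymbol{x}_p,-r)$,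 and let $\Omega=\Omega_D=\{\boldsymbol{x}_p+r\underline\omega:\ \underline\omega\in\mathbb{S},\ r\ge0,\ (\boldsymbol{x}_p,r)\in D\}$. Let $f:\Omega_D\to\mathbb{O}$ be a $C^1$ generalized partial-slice function, i.e. $f(\boldsymbol{x}_p+r\underline\omega)=F_1(\boldsymbol{x}_p,r)+\underline\omega F_2(\boldsymbol{x}_p,r)$ for $\underline\omega\in\mathbb{S}$, $r\ge 0$, $(\boldsymbol{x}_p,r)\in D$, with $F_1,F_2\in C^1(D,\mathbb{O})$, $F_1$ even and $F_2$ odd in $r$. Put $E(\boldsymbol{x})=\frac{1}{\sigma_{p+1}}\frac{\overline{\boldsymbol{x}}}{|\boldsymbol{x}|^{p+2}}$ with $\sigma_{p+1}=2\,\Gamma(\tfrac12)^{p+2}/\Gamma(\tfrac{p+2}{2})$, $E_{\boldsymbol{y}}(\boldsymbol{x})=E(\boldsymbol{y}-\boldsymbol{x})$, and for $\underline\eta\in\mathbb{S}$, $\boldsymbol{y}\in\mathbb{R}^{p+1}\oplus\underline\eta\mathbb{R}$, $\boldsymbol{x}=\boldsymbol{x}_p+r\underline\omega$ ($r\ge0$,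 $\underline\omega\in\mathbb{S}$) define the operator on $\mathbb{O}$ $$\mathcal{E}_{\boldsymbol{y}}(\boldsymbol{x})=\tfrac12L_{E_{\boldsymbol{y}}(\boldsymbol{x}_p+r\underline\eta)+E_{\boldsymbol{y}}(\boldsymbol{x}_p-r\underline\eta)}+\tfrac12L_{\underline\omega}L_{\underline\eta}L_{E_{\boldsymbol{y}}(\boldsymbol{x}_p-r\underline\eta)-E_{\boldsymbol{y}}(\boldsymbol{x}_p+r\underline\eta)}.$$ Let $\underline\eta\in\mathbb{S}$ and let $U$ be a domain in $\mathbb{O}$ such that $U_{\underline\eta}\subset\Omega_{\underline\eta}$ is a bounded domain in $\mathbb{R}^{p+2}$ with smooth boundary $\partial U_{\underline\eta}\subset\Omega_{\underline\eta}$. Then for every $\boldsymbol{x}=\boldsymbol{x}_p+r\underline\omega\in\mathbb{O}$ ($r\ge0$, $\underline\omega\in\mathbb{S}$) such that $\boldsymbol{x}_p+r\underline\eta$ and $\boldsymbol{x}_p-r\underline\eta$ both lie in $U_{\underline\eta}$ (which is the case for every $\boldsymbol{x}\in U$ if $U$ is symmetric, that is, if $\boldsymbol{x}_p+r\underline\omega\in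 U$ with $r>0$ implies $\boldsymbol{x}_p+r\mathbb{S}\subseteq U$), $$f(\boldsymbol{x})=\int_{\partial U_{\underline\eta}}\mathcal{E}_{\boldsymbol{y}}(\boldsymbol{x})\big(\boldsymbol{n}(\boldsymbol{y})f(\boldsymbol{y})\big)\,dS(\boldsymbol{y})-\int_{U_{\underline\eta}}\mathcal{E}_{\boldsymbol{y}}(\boldsymbol{x})\big(D_{\underline\eta}f(\boldsymbol{y})\big)\,dV(\boldsymbol{y}),$$ both integrals being absolutely convergent. Here $\boldsymbol{n}=\sum_{i=0}^{p}n_ie_i+n_{p+1}\underline\eta$ is the unit exterior normal to $\partial U_{\underline\eta}$, $D_{\underline\eta}f=\sum_{i=0}^{p}e_i\partial_{x_i}f+\underline\eta\,\partial_rf$ on $U_{\underline\eta}$, and $dS$, $dV$ are the Lebesgue surface and volume elements in $\mathbb{R}^{p+2}$. -/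

import Mathlib

open MeasureTheory Set Topology
open scoped ContDiff

noncomputable section

namespace PartialSlice

/-! ### Octonions -/

/-- The underlying Euclidean space `ℝ⁸` of the octonions; `x i` is the coefficient of `e_i`. -/
abbrev Oct : Type := EuclideanSpace ℝ (Fin 8)

/-- The index triples `(i,j,k)` with `e_i e_j = e_k`, up to cyclic permutation. -/
def octTriples : Finset (Fin 8 × Fin 8 × Fin 8) :=
  {(1, 2, 3), (1, 4, 5), (2, 4, 6), (3, 4, 7), (5, 3, 6), (6, 1, 7), (7, 2, 5)}

/-- The totally antisymmetric symbol `ε_{ijk}`: the sign of the permutation taking a triple of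
`octTriples` to `(i,j,k)`, and `0` if there is none. -/
def octEps (i j k : Fin 8) : ℤ :=
  if (i, j, k) ∈ octTriples ∨ (j, k, i) ∈ octTriples ∨ (k, i, j) ∈ octTriples then 1
  else if (j, i, k) ∈ octTriples ∨ (i, k, j) ∈ octTriples ∨ (k, j, i) ∈ octTriples then -1
  else 0

/-- The coefficient of `e_k` in `e_i e_j`, where `e_0 = 1` and
`e_i e_j = -δ_{ij} + ∑_k ε_{ijk} e_k` for `i, j ≥ 1`. -/
def octCoeff (i j k : Fin 8) : ℤ :=
  if i = 0 then (if j = k then 1 else 0)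
  else if j = 0 then (if i = k then 1 else 0)
  else if k = 0 then (if i = j then -1 else 0)
  else octEps i j k

/-- Octonion multiplication. -/
instance : Mul Oct where
  mul x y := WithLp.toLp 2 fun k => ∑ i, ∑ j, (octCoeff i j k : ℝ) * (x i * y j)

theorem oct_mul_apply (x y : Oct) (k : Fin 8) :
    (x * y) k = ∑ i, ∑ j, (octCoeff i j k : ℝ) * (x i * y j) := rfl

/-- Octonion conjugation. -/
def octConj (x : Oct) : Oct := WithLp.toLp 2 fun i => if i = 0 then x i else -x i

/-- The operator `L_a` of left multiplication by `a`. -/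
def leftMul (a : Oct) : Oct →ₗ[ℝ] Oct where
  toFun x := a * x
  map_add' x y := by
    ext k
    simp only [oct_mul_apply, PiLp.add_apply, mul_add, Finset.sum_add_distrib]
  map_smul' c x := by
    ext k
    simp only [oct_mul_apply, PiLp.smul_apply, smul_eq_mul, Finset.mul_sum, RingHom.id_apply]
    exact Finset.sum_congr rfl fun i _ => Finset.sum_congr rfl fun j _ => by ring

/-! ### Slices -/

/-- `ℝ^{p+2}`, whose points are written `x' = (x_0, …, x_p, r)`. -/
abbrev SliceSpace (p : ℕ) : Type := EuclideanSpace ℝ (Fin (p + 2))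

/-- The basis octonion `e_k`, for `k ≤ 7`. -/
def octBasis (k : ℕ) : Oct := WithLp.toLp 2 fun i => if (i : ℕ) = k then 1 else 0

/-- The unit sphere `𝕊` of `span(e_{p+1}, …, e_7)`. -/
def imSphere (p : ℕ) : Set Oct := {w | (∀ i : Fin 8, (i : ℕ) ≤ p → w i = 0) ∧ ‖w‖ = 1}

/-- The map `(x_0, …, x_p, r) ↦ x_0 + x_1 e_1 + ⋯ + x_p e_p + r ω` identifying `ℝ^{p+2}` with the
slice `ℝ^{p+1} ⊕ ωℝ` of the octonions. -/
def sliceEmbed (p : ℕ) (w : Oct) (x : SliceSpace p) : Oct :=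
  ∑ i : Fin (p + 1), x i.castSucc • octBasis i + x (Fin.last (p + 1)) • w

/-- The slice `Ω_ω = Ω ∩ (ℝ^{p+1} ⊕ ωℝ)`, as a subset of `ℝ^{p+2}`. -/
def slice (p : ℕ) (w : Oct) (Om : Set Oct) : Set (SliceSpace p) := {x | sliceEmbed p w x ∈ Om}

/-- The reflection `(x_p, r) ↦ (x_p, -r)`. -/
def reflect (p : ℕ) (x : SliceSpace p) : SliceSpace p :=
  WithLp.toLp 2 fun i => if i = Fin.last (p + 1) then -x i else x i

/-- The `p`-symmetric completion `Ω_D`. -/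
def symCompletion (p : ℕ) (D : Set (SliceSpace p)) : Set Oct :=
  {x | ∃ w ∈ imSphere p, ∃ x' ∈ D, 0 ≤ x' (Fin.last (p + 1)) ∧ x = sliceEmbed p w x'}

/-- `(F₁, F₂)` is a stem function on `D`. -/
def IsStem (p : ℕ) (D : Set (SliceSpace p)) (F₁ F₂ : SliceSpace p → Oct) : Prop :=
  ∀ x' ∈ D, F₁ (reflect p x') = F₁ x' ∧ F₂ (reflect p x') = -F₂ x'

/-- `f ∈ 𝒢𝒮¹(Ω_D)`: on `Ω_D`, `f` is induced by a stem function of class `C¹` on `D`, that is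
`f(x_p + rω) = F₁(x_p, r) + ω F₂(x_p, r)`. -/
def IsGS1 (p : ℕ) (D : Set (SliceSpace p)) (f : Oct → Oct) : Prop :=
  ∃ F₁ F₂ : SliceSpace p → Oct, IsStem p D F₁ F₂ ∧
    ContDiffOn ℝ 1 F₁ D ∧ ContDiffOn ℝ 1 F₂ D ∧
    ∀ w ∈ imSphere p, ∀ x' ∈ D, 0 ≤ x' (Fin.last (p + 1)) →
      f (sliceEmbed p w x') = F₁ x' + w * F₂ x'

/-- The operator `D_η f = ∑_{i ≤ p} e_i ∂_{x_i} f_η + η ∂_r f_η`, at the point of the slice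
`ℝ^{p+1} ⊕ ηℝ` with coordinates `y`. -/
def sliceD (p : ℕ) (η : Oct) (f : Oct → Oct) (y : SliceSpace p) : Oct :=
  ∑ i : Fin (p + 1), octBasis i *
      fderiv ℝ (fun z => f (sliceEmbed p η z)) y (EuclideanSpace.single i.castSucc 1)
    + η * fderiv ℝ (fun z => f (sliceEmbed p η z)) y (EuclideanSpace.single (Fin.last (p + 1)) 1)

/-! ### Cauchy kernels -/

/-- The area `σ_{p+1} = 2 Γ(1/2)^{p+2} / Γ((p+2)/2)` of the unit sphere in `ℝ^{p+2}`. -/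
def sphereArea (p : ℕ) : ℝ := 2 * Real.Gamma (1 / 2) ^ (p + 2) / Real.Gamma (((p : ℝ) + 2) / 2)

/-- The Cauchy kernel `E(x) = σ_{p+1}⁻¹ x̄ / |x|^{p+2}`. -/
def cauchyE (p : ℕ) (x : Oct) : Oct := (1 / (sphereArea p * ‖x‖ ^ (p + 2))) • octConj x

/-- `E_y(x) = E(y - x)`. -/
def cauchyEAt (p : ℕ) (y x : Oct) : Oct := cauchyE p (y - x)

/-- The operator-valued kernel `𝓔_y(x)` for `x = x_p + rω` with coordinates `x' = (x_p, r)` and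
`y = y_p + r̃η` with coordinates `y' = (y_p, r̃)`. -/
def globalKernel (p : ℕ) (η w : Oct) (y' x' : SliceSpace p) : Oct →ₗ[ℝ] Oct :=
  (1 / 2 : ℝ) • leftMul (cauchyEAt p (sliceEmbed p η y') (sliceEmbed p η x')
      + cauchyEAt p (sliceEmbed p η y') (sliceEmbed p η (reflect p x')))
  + (1 / 2 : ℝ) • (leftMul w ∘ₗ leftMul η ∘ₗ
      leftMul (cauchyEAt p (sliceEmbed p η y') (sliceEmbed p η (reflect p x'))
        - cauchyEAt p (sliceEmbed p η y') (sliceEmbed p η x')))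

/-! ### Smooth boundaries -/

/-- `ρ` is a smooth defining function of `W` near `y`: it is `C^∞` on a neighbourhood of `y` in
which `W` is `{ρ < 0}`, and its gradient does not vanish at `y`. -/
def IsDefiningFun {n : ℕ} (W : Set (EuclideanSpace ℝ (Fin n))) (y : EuclideanSpace ℝ (Fin n))
    (ρ : EuclideanSpace ℝ (Fin n) → ℝ) : Prop :=
  (∃ N, IsOpen N ∧ y ∈ N ∧ ContDiffOn ℝ ∞ ρ N ∧ ∀ z ∈ N, (z ∈ W ↔ ρ z < 0)) ∧ gradient ρ y ≠ 0

/-- `W` has a smooth boundary. -/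
def HasSmoothBoundary {n : ℕ} (W : Set (EuclideanSpace ℝ (Fin n))) : Prop :=
  ∀ y ∈ frontier W, ∃ ρ, IsDefiningFun W y ρ

/-- `v` is the unit exterior normal to `∂W` at `y`: the normalized gradient of a local defining
function. -/
def IsUnitExteriorNormal {n : ℕ} (W : Set (EuclideanSpace ℝ (Fin n)))
    (y v : EuclideanSpace ℝ (Fin n)) : Prop :=
  ∃ ρ, IsDefiningFun W y ρ ∧ v = ‖gradient ρ y‖⁻¹ • gradient ρ y

open Classical in
/-- The unit exterior normal field of `W` (only its values on a smooth boundary matter). -/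
def unitExteriorNormal {n : ℕ} (W : Set (EuclideanSpace ℝ (Fin n)))
    (y : EuclideanSpace ℝ (Fin n)) : EuclideanSpace ℝ (Fin n) :=
  if h : ∃ v, IsUnitExteriorNormal W y v then h.choose else 0

/-- The surface measure `dS` on the boundary of `W ⊆ ℝ^{p+2}`: the `(p+1)`-dimensional Hausdorff
measure, normalized so that it is Lebesgue measure on `ℝ^{p+1}`, restricted to `∂W`. -/
def surfaceMeasure (p : ℕ) (W : Set (SliceSpace p)) : Measure (SliceSpace p) :=
  (Measure.euclideanHausdorffMeasure (p + 1)).restrict (frontier W)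

end PartialSlice

end

open PartialSlice

/-!
The formula is the Cauchy–Pompeiu formula on the single slice `ℝ^{p+1} ⊕ ηℝ`, written at the two
points `x_p ± rη`, and carried to `x_p + rω` by the representation formula
`f(x_p + rω) = ½ (f(x_p + rη) + f(x_p - rη)) + ½ ω(η(f(x_p - rη) - f(x_p + rη)))`
(`representation_formula`), which follows from `f = F₁ + ωF₂` and `η(ηa) = -a`. The kernel
`𝓔_y(x)` is the same linear combination of `E_y(x_p + rη)` and `E_y(x_p - rη)`.

Octonions are not associative, but on a slice only the identity `z̄(za) = |z|²a` is used
(`octConj_mul_mul_self`). The formula on a slice is therefore proved for linear families of operators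
`ē(z)`, `e(z)` with `ē(z)e(z) = |z|²` (`cauchy_pompeiu`). Let
`K_ε(z) = (|z|² + ε²)^{-(m+1)/2} ē(z)` on `ℝᵐ⁺¹`. It is smooth, and
`∑ᵢ ∂ᵢ(K_ε e(bᵢ) g) = K_ε ∑ᵢ e(bᵢ) ∂ᵢg + δ_ε g`, where `δ_ε = (m+1) ε² (|z|² + ε²)^{-(m+3)/2}` is a
positive scalar density, which concentrates at the origin with total mass the area of the unit
sphere. The divergence theorem for `K_ε e(bᵢ) g`, followed by `ε → 0` under dominated convergence,
gives the formula without excising a ball around the singularity.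

The divergence theorem for a bounded open set `W` with smooth boundary and Hausdorff surface
measure (`divergenceIdentity`) is localized by a partition of unity. Near a boundary point and for a
direction `u` transversal to the boundary, `W` is a subgraph along `u` (`exists_isSubgraph`), and
Fubini with the fundamental theorem of calculus reduces both sides to the same integral over the
base of the graph, because the area element `√(1 + |∇g|²)` and the factor `⟪ν, u⟫` cancel. Any
direction is a difference of two transversal ones, so no tangential integration by parts is needed.

The surface measure of a graph is computed in `restrict_image_graph_eq_map`: on a small set, the
parametrization `x ↦ (x, g x)` distorts distances, up to a factor close to `1`, as a linear
automorphism of `ℝᵐ` of determinant `√(1 + |∇g|²)` does (`graphModel`). Hausdorff and Lebesgue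
measure agree on `ℝᵐ`, so the two measures agree up to a factor close to `1` on small sets, and
summation over a countable partition makes them equal.
-/

namespace PartialSlice

open Filter Metric
open scoped NNReal ENNReal RealInnerProductSpace

/-! ### Surface measure of a graph -/

section Area

theorem _root_.LipschitzOnWith.euclideanHausdorffMeasure_image_le {X Y : Type*}
    [EMetricSpace X] [MeasurableSpace X] [BorelSpace X]
    [EMetricSpace Y] [MeasurableSpace Y] [BorelSpace Y] {K : ℝ≥0} {f : X → Y} {s : Set X}
    (h : LipschitzOnWith K f s) (d : ℕ) :
    Measure.euclideanHausdorffMeasure d (f '' s) ≤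
      (K : ℝ≥0∞) ^ d * Measure.euclideanHausdorffMeasure d s := by
  have := h.hausdorffMeasure_image_le (d := d) (Nat.cast_nonneg d)
  simp only [Measure.euclideanHausdorffMeasure_def, Measure.smul_apply, ENNReal.smul_def,
    smul_eq_mul]
  rw [ENNReal.rpow_natCast] at this
  calc _ ≤ _ := mul_le_mul_right this _
    _ = _ := by ring

/-- If one measure is dominated by another near every point of `B`, it is dominated on `B`. -/
theorem restrict_le_of_forall_nhdsWithin {X : Type*} [TopologicalSpace X]
    [SecondCountableTopology X] [MeasurableSpace X] [OpensMeasurableSpace X]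
    {μ ν : Measure X} {B : Set X}
    (h : ∀ x ∈ B, ∃ N, IsOpen N ∧ x ∈ N ∧ ∀ A, MeasurableSet A → A ⊆ N ∩ B → μ A ≤ ν A)
    (hB : MeasurableSet B) : μ.restrict B ≤ ν.restrict B := by
  choose! N hNo hxN hN using h
  obtain ⟨t, htB, htc, hcov⟩ := TopologicalSpace.countable_cover_nhdsWithin
    (f := N) (s := B) fun x hx => mem_nhdsWithin_of_mem_nhds ((hNo x hx).mem_nhds (hxN x hx))
  rcases t.eq_empty_or_nonempty with rfl | htne
  · have : B = ∅ := by simpa using hcov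
    simp [this]
  obtain ⟨e, he⟩ := htc.exists_eq_range htne
  have heB : ∀ i, e i ∈ B := fun i => htB (he ▸ mem_range_self i)
  refine Measure.le_iff.2 fun A hA => ?_
  rw [Measure.restrict_apply hA, Measure.restrict_apply hA]
  have hmeas : ∀ i, MeasurableSet (disjointed (fun i => N (e i)) i) :=
    MeasurableSet.disjointed fun i => (hNo _ (heB i)).measurableSet
  have hdec : A ∩ B = ⋃ i, (A ∩ B) ∩ disjointed (fun i => N (e i)) i := by
    rw [← inter_iUnion, iUnion_disjointed, eq_comm, inter_eq_left]
    refine inter_subset_right.trans (hcov.trans ?_)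
    rw [he, biUnion_range]
  have hdisj : Pairwise (Function.onFun Disjoint
      fun i => (A ∩ B) ∩ disjointed (fun i => N (e i)) i) := fun i j hij =>
    (disjoint_disjointed _ hij).mono inter_subset_right inter_subset_right
  rw [hdec, measure_iUnion hdisj fun i => (hA.inter hB).inter (hmeas i),
    measure_iUnion hdisj fun i => (hA.inter hB).inter (hmeas i)]
  refine ENNReal.tsum_le_tsum fun i => hN _ (heB i) _ ((hA.inter hB).inter (hmeas i)) ?_
  exact fun x hx => ⟨disjointed_subset (fun i => N (e i)) i hx.2, hx.1.2⟩

variable {m : ℕ}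

/-- A linear automorphism of `ℝᵐ` with the same metric distortion `‖M x‖² = ‖x‖² + ⟪a, x⟫²` as the
parametrization `x ↦ (x, ⟪a, x⟫)` of the graph of `⟪a, ·⟫`. Its determinant is `√(1 + ‖a‖²)`. -/
noncomputable def graphModel (a : EuclideanSpace ℝ (Fin m)) :
    EuclideanSpace ℝ (Fin m) →ₗ[ℝ] EuclideanSpace ℝ (Fin m) :=
  LinearMap.transvection (innerₛₗ ℝ a) ((1 + √(1 + ‖a‖ ^ 2))⁻¹ • a)

theorem det_graphModel (a : EuclideanSpace ℝ (Fin m)) :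
    (graphModel a).det = √(1 + ‖a‖ ^ 2) := by
  have h1 : 0 ≤ √(1 + ‖a‖ ^ 2) := Real.sqrt_nonneg _
  have h2 : √(1 + ‖a‖ ^ 2) ^ 2 = 1 + ‖a‖ ^ 2 := Real.sq_sqrt (by positivity)
  rw [graphModel, LinearMap.transvection.det]
  simp only [innerₛₗ_apply_apply, inner_smul_right, real_inner_self_eq_norm_sq]
  field_simp
  linarith

theorem norm_graphModel_sq (a x : EuclideanSpace ℝ (Fin m)) :
    ‖graphModel a x‖ ^ 2 = ‖x‖ ^ 2 + ⟪a, x⟫ ^ 2 := by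
  have h1 : 0 ≤ √(1 + ‖a‖ ^ 2) := Real.sqrt_nonneg _
  have h2 : √(1 + ‖a‖ ^ 2) ^ 2 = 1 + ‖a‖ ^ 2 := Real.sq_sqrt (by positivity)
  have : graphModel a x = x + (⟪a, x⟫ * (1 + √(1 + ‖a‖ ^ 2))⁻¹) • a := by
    simp [graphModel, LinearMap.transvection.apply, smul_smul]
  rw [this, norm_add_sq_real, norm_smul, inner_smul_right, real_inner_comm, mul_pow,
    Real.norm_eq_abs, sq_abs]
  generalize √(1 + ‖a‖ ^ 2) = s at h1 h2 ⊢
  rw [eq_sub_of_add_eq' h2.symm]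
  field_simp
  ring

theorem norm_le_norm_graphModel (a x : EuclideanSpace ℝ (Fin m)) : ‖x‖ ≤ ‖graphModel a x‖ :=
  le_of_sq_le_sq (by rw [norm_graphModel_sq]; nlinarith [sq_nonneg ⟪a, x⟫]) (norm_nonneg _)

theorem graphModel_injective (a : EuclideanSpace ℝ (Fin m)) :
    Function.Injective (graphModel a) := by
  refine (injective_iff_map_eq_zero _).2 fun x hx => ?_
  have := norm_le_norm_graphModel a x
  simpa [hx] using this

/-- A `C¹` graph is, near each point and up to a factor `1 + c`, metrically the linear model. -/
theorem exists_dist_graph_le {E : Type*} [MetricSpace E] {g : EuclideanSpace ℝ (Fin m) → ℝ}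
    {Φ : EuclideanSpace ℝ (Fin m) → E}
    (hΦ : ∀ x y, dist (Φ x) (Φ y) ^ 2 = ‖x - y‖ ^ 2 + (g x - g y) ^ 2)
    {x₀ : EuclideanSpace ℝ (Fin m)} (hg : ContDiffAt ℝ 1 g x₀) {c : ℝ} (hc : 0 < c) :
    ∃ N, IsOpen N ∧ x₀ ∈ N ∧ ∀ x ∈ N, ∀ y ∈ N,
      |dist (Φ x) (Φ y) - ‖graphModel (gradient g x₀) (x - y)‖| ≤
        c * ‖graphModel (gradient g x₀) (x - y)‖ := by
  have hs : HasStrictFDerivAt g (fderiv ℝ g x₀) x₀ := hg.hasStrictFDerivAt one_ne_zero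
  lift c to ℝ≥0 using hc.le
  obtain ⟨N, hN, hNl⟩ := hs.approximates_deriv_on_nhds (c := c) (Or.inr (by exact_mod_cast hc))
  refine ⟨interior N, isOpen_interior, mem_interior_iff_mem_nhds.2 hN, fun x hx y hy => ?_⟩
  have h1 := hNl x (interior_subset hx) y (interior_subset hy)
  set a := gradient g x₀ with ha
  have hgrad : fderiv ℝ g x₀ (x - y) = ⟪a, x - y⟫ := by
    rw [ha, gradient, InnerProductSpace.toDual_symm_apply]
  rw [hgrad, Real.norm_eq_abs] at h1
  set M := ‖graphModel a (x - y)‖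
  have hM : M ^ 2 = ‖x - y‖ ^ 2 + ⟪a, x - y⟫ ^ 2 := norm_graphModel_sq _ _
  have hM0 : ‖x - y‖ ≤ M := norm_le_norm_graphModel _ _
  have hd := hΦ x y
  -- reverse triangle inequality in the plane, for the points `(‖x - y‖, ·)`
  have key : |dist (Φ x) (Φ y) - M| ≤ |g x - g y - ⟪a, x - y⟫| := by
    have e1 : dist (Φ x) (Φ y) = ‖(⟨‖x - y‖, g x - g y⟩ : ℂ)‖ := by
      rw [Complex.norm_eq_sqrt_sq_add_sq, ← hd, Real.sqrt_sq dist_nonneg]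
    have e2 : M = ‖(⟨‖x - y‖, ⟪a, x - y⟫⟩ : ℂ)‖ := by
      rw [Complex.norm_eq_sqrt_sq_add_sq, ← hM, Real.sqrt_sq (norm_nonneg _)]
    rw [e1, e2]
    refine (abs_norm_sub_norm_le _ _).trans (le_of_eq ?_)
    rw [Complex.norm_eq_sqrt_sq_add_sq]
    simp [Real.sqrt_sq_eq_abs]
  exact key.trans (h1.trans (by gcongr))

variable {E : Type*} [MetricSpace E] [MeasurableSpace E] [BorelSpace E]

theorem euclideanHausdorffMeasure_image_le_of_dist_le
    {Φ : EuclideanSpace ℝ (Fin m) → E}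
    {a : EuclideanSpace ℝ (Fin m)} {A : Set (EuclideanSpace ℝ (Fin m))} {K : ℝ≥0}
    (h : ∀ x ∈ A, ∀ y ∈ A, dist (Φ x) (Φ y) ≤ K * ‖graphModel a (x - y)‖) :
    Measure.euclideanHausdorffMeasure m (Φ '' A) ≤
      (K : ℝ≥0∞) ^ m * (ENNReal.ofReal √(1 + ‖a‖ ^ 2) * volume A) := by
  set M := graphModel a
  have hinv : ∀ x, Function.invFun M (M x) = x :=
    Function.leftInverse_invFun (graphModel_injective a)
  have hlip : LipschitzOnWith K (Φ ∘ Function.invFun M) (M '' A) := by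
    refine LipschitzOnWith.of_dist_le_mul ?_
    rintro _ ⟨x, hx, rfl⟩ _ ⟨y, hy, rfl⟩
    simpa [hinv, dist_eq_norm, ← map_sub] using h x hx y hy
  have := hlip.euclideanHausdorffMeasure_image_le m
  rw [image_image, EuclideanSpace.euclideanHausdorffMeasure_eq_volume,
    Measure.addHaar_image_linearMap, det_graphModel, abs_of_nonneg (Real.sqrt_nonneg _)] at this
  simpa [hinv] using this

theorem le_euclideanHausdorffMeasure_image_of_le_dist
    {Φ : EuclideanSpace ℝ (Fin m) → E} (hinj : Function.Injective Φ)
    {a : EuclideanSpace ℝ (Fin m)} {A : Set (EuclideanSpace ℝ (Fin m))} {K : ℝ≥0}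
    (h : ∀ x ∈ A, ∀ y ∈ A, ‖graphModel a (x - y)‖ ≤ K * dist (Φ x) (Φ y)) :
    ENNReal.ofReal √(1 + ‖a‖ ^ 2) * volume A ≤
      (K : ℝ≥0∞) ^ m * Measure.euclideanHausdorffMeasure m (Φ '' A) := by
  set M := graphModel a
  have hinv : ∀ x, Function.invFun Φ (Φ x) = x := Function.leftInverse_invFun hinj
  have hlip : LipschitzOnWith K (M ∘ Function.invFun Φ) (Φ '' A) := by
    refine LipschitzOnWith.of_dist_le_mul ?_
    rintro _ ⟨x, hx, rfl⟩ _ ⟨y, hy, rfl⟩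
    simpa [hinv, dist_eq_norm, ← map_sub] using h x hx y hy
  have := hlip.euclideanHausdorffMeasure_image_le m
  rw [image_image, EuclideanSpace.euclideanHausdorffMeasure_eq_volume] at this
  simp only [Function.comp_apply, hinv] at this
  rwa [Measure.addHaar_image_linearMap, det_graphModel, abs_of_nonneg (Real.sqrt_nonneg _)] at this

theorem continuousAt_gradient {F : Type*} [NormedAddCommGroup F] [InnerProductSpace ℝ F]
    [CompleteSpace F] {g : F → ℝ} {x : F} (hg : ContDiffAt ℝ 1 g x) :
    ContinuousAt (gradient g) x :=
  ((InnerProductSpace.toDual ℝ F).symm.continuous.continuousAt).comp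
    (hg.continuousAt_fderiv one_ne_zero)

theorem measurable_gradient (g : EuclideanSpace ℝ (Fin m) → ℝ) : Measurable (gradient g) :=
  (InnerProductSpace.toDual ℝ (EuclideanSpace ℝ (Fin m))).symm.continuous.measurable.comp
    (measurable_fderiv ℝ g)

/-- The area element `√(1 + |∇g|²)` of the graph of `g`. -/
noncomputable def graphArea (g : EuclideanSpace ℝ (Fin m) → ℝ) (x : EuclideanSpace ℝ (Fin m)) : ℝ :=
  √(1 + ‖gradient g x‖ ^ 2)

theorem measurable_graphArea (g : EuclideanSpace ℝ (Fin m) → ℝ) : Measurable (graphArea g) := by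
  have := measurable_gradient g
  unfold graphArea
  fun_prop

theorem graphArea_pos (g : EuclideanSpace ℝ (Fin m) → ℝ) (x) : 0 < graphArea g x :=
  Real.sqrt_pos.2 (by positivity)

theorem continuousAt_graphArea {g : EuclideanSpace ℝ (Fin m) → ℝ} {x}
    (hg : ContDiffAt ℝ 1 g x) : ContinuousAt (graphArea g) x := by
  have := continuousAt_gradient hg
  unfold graphArea
  fun_prop

theorem exists_pow_le {κ : ℝ} (hκ : 1 < κ) (m : ℕ) :
    ∃ c : ℝ, 0 < c ∧ c < 1 ∧ (1 + c) ^ m * (1 + c) ≤ κ ∧ (1 + c) * ((1 - c)⁻¹) ^ m ≤ κ := by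
  have h1 : ContinuousAt (fun c : ℝ => (1 + c) ^ m * (1 + c)) 0 := by fun_prop
  have h2 : ContinuousAt (fun c : ℝ => (1 + c) * ((1 - c)⁻¹) ^ m) 0 := by
    have : (1 : ℝ) - 0 ≠ 0 := by norm_num
    fun_prop (disch := assumption)
  have e1 := h1.eventually_lt_const (show (1 + 0 : ℝ) ^ m * (1 + 0) < κ by simpa using hκ)
  have e2 := h2.eventually_lt_const (show (1 + 0 : ℝ) * ((1 - 0)⁻¹) ^ m < κ by simpa using hκ)
  have e3 : ∀ᶠ c : ℝ in 𝓝 0, c < 1 := eventually_lt_nhds one_pos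
  have e : ∀ᶠ c : ℝ in 𝓝[>] 0, 0 < c ∧ c < 1 ∧ (1 + c) ^ m * (1 + c) ≤ κ ∧
      (1 + c) * ((1 - c)⁻¹) ^ m ≤ κ := by
    filter_upwards [self_mem_nhdsWithin, e1.filter_mono nhdsWithin_le_nhds,
      e2.filter_mono nhdsWithin_le_nhds, e3.filter_mono nhdsWithin_le_nhds] with c h0 h1 h2 h3
    exact ⟨h0, h3, h1.le, h2.le⟩
  exact e.exists

/-- Up to a factor `κ > 1`, the surface measure of a small piece of a `C¹` graph is the integral of
the area element. -/
theorem exists_area_graph_le {g : EuclideanSpace ℝ (Fin m) → ℝ} {Φ : EuclideanSpace ℝ (Fin m) → E}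
    (hΦ : ∀ x y, dist (Φ x) (Φ y) ^ 2 = ‖x - y‖ ^ 2 + (g x - g y) ^ 2)
    (hinj : Function.Injective Φ)
    {x₀ : EuclideanSpace ℝ (Fin m)} (hg : ContDiffAt ℝ 1 g x₀) {κ : ℝ≥0} (hκ : 1 < κ) :
    ∃ N, IsOpen N ∧ x₀ ∈ N ∧ ∀ A, MeasurableSet A → A ⊆ N →
      Measure.euclideanHausdorffMeasure m (Φ '' A) ≤
        κ * ∫⁻ x in A, ENNReal.ofReal (graphArea g x) ∧
      ∫⁻ x in A, ENNReal.ofReal (graphArea g x) ≤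
        κ * Measure.euclideanHausdorffMeasure m (Φ '' A) := by
  obtain ⟨c, hc0, hc1, hcm, hcm'⟩ := exists_pow_le (κ := κ) (by exact_mod_cast hκ) m
  obtain ⟨N₁, hN₁, hx₁, hd⟩ := exists_dist_graph_le hΦ hg hc0
  have hJ := continuousAt_graphArea hg
  have hJ0 := graphArea_pos g x₀
  obtain ⟨N₂, hN₂, hN₂o, hx₂⟩ := _root_.eventually_nhds_iff.1
    ((hJ.eventually_lt_const (show graphArea g x₀ < (1 + c) * graphArea g x₀ by nlinarith)).and
      (hJ.eventually_const_lt (show graphArea g x₀ / (1 + c) < graphArea g x₀ by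
        rw [div_lt_iff₀ (by positivity)]; nlinarith)))
  refine ⟨N₁ ∩ N₂, hN₁.inter hN₂o, ⟨hx₁, hx₂⟩, fun A hA hAN => ?_⟩
  have hup : ∫⁻ x in A, ENNReal.ofReal (graphArea g x) ≤
      ENNReal.ofReal (1 + c) * (ENNReal.ofReal (graphArea g x₀) * volume A) := by
    rw [← mul_assoc, ← ENNReal.ofReal_mul (by positivity), ← setLIntegral_const]
    exact setLIntegral_mono measurable_const fun x hx =>
      ENNReal.ofReal_le_ofReal (hN₂ x (hAN hx).2).1.le
  have hlow : ENNReal.ofReal (graphArea g x₀) * volume A ≤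
      ENNReal.ofReal (1 + c) * ∫⁻ x in A, ENNReal.ofReal (graphArea g x) := by
    rw [← setLIntegral_const, ← lintegral_const_mul _ (by have := measurable_graphArea g; fun_prop)]
    refine setLIntegral_mono' hA fun x hx => ?_
    rw [← ENNReal.ofReal_mul (by positivity)]
    refine ENNReal.ofReal_le_ofReal ?_
    have := (hN₂ x (hAN hx).2).2
    rw [div_lt_iff₀ (by positivity)] at this
    linarith
  constructor
  · have h1 := euclideanHausdorffMeasure_image_le_of_dist_le (Φ := Φ) (a := gradient g x₀) (A := A)
      (K := (1 + c).toNNReal) fun x hx y hy => by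
        rw [Real.coe_toNNReal _ (by positivity)]
        linarith [(abs_le.1 (hd x (hAN hx).1 y (hAN hy).1)).2]
    refine h1.trans ?_
    calc _ ≤ ((1 + c).toNNReal : ℝ≥0∞) ^ m * (ENNReal.ofReal (1 + c) *
          ∫⁻ x in A, ENNReal.ofReal (graphArea g x)) :=
          mul_le_mul' le_rfl hlow
      _ = ENNReal.ofReal ((1 + c) ^ m * (1 + c)) * _ := by
          rw [← mul_assoc, ENNReal.ofReal_mul (by positivity), ENNReal.ofReal_pow (by positivity)]
          rfl
      _ ≤ _ := by gcongr; exact ENNReal.ofReal_le_of_le_toReal hcm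
  · have h1 := le_euclideanHausdorffMeasure_image_of_le_dist hinj (a := gradient g x₀) (A := A)
      (K := ((1 - c)⁻¹).toNNReal) fun x hx y hy => by
        have h0 : 0 < 1 - c := by linarith
        rw [Real.coe_toNNReal _ (by positivity), inv_mul_eq_div, le_div_iff₀ h0]
        linarith [(abs_le.1 (hd x (hAN hx).1 y (hAN hy).1)).1]
    have h0 : 0 < 1 - c := by linarith
    refine hup.trans ?_
    calc _ ≤ ENNReal.ofReal (1 + c) * ((((1 - c)⁻¹).toNNReal : ℝ≥0∞) ^ m *
          Measure.euclideanHausdorffMeasure m (Φ '' A)) :=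
          mul_le_mul' le_rfl h1
      _ = ENNReal.ofReal ((1 + c) * ((1 - c)⁻¹) ^ m) * _ := by
          rw [← mul_assoc, ENNReal.ofReal_mul (by positivity), ENNReal.ofReal_pow (by positivity)]
          rfl
      _ ≤ _ := by gcongr; exact ENNReal.ofReal_le_of_le_toReal hcm'

theorem _root_.ENNReal.le_of_forall_one_lt_le_mul {a b : ℝ≥0∞}
    (h : ∀ κ : ℝ≥0, 1 < κ → a ≤ κ * b) : a ≤ b := by
  have h1 : Tendsto (fun κ : ℝ≥0 => (κ : ℝ≥0∞) * b) (𝓝[>] 1) (𝓝 ((1 : ℝ≥0) * b)) :=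
    ENNReal.Tendsto.mul_const
      ((ENNReal.continuous_coe.tendsto 1).mono_left nhdsWithin_le_nhds) (Or.inl (by simp))
  rw [ENNReal.coe_one, one_mul] at h1
  exact ge_of_tendsto h1 (by filter_upwards [self_mem_nhdsWithin] with κ hκ using h κ hκ)

/-- The area formula for a `C¹` graph `Φ x = (x, g x)`: the surface measure on `Φ '' B` is the image
under `Φ` of `√(1 + |∇g|²) dx`. -/
theorem restrict_image_graph_eq_map {g : EuclideanSpace ℝ (Fin m) → ℝ}
    {Φ : EuclideanSpace ℝ (Fin m) → E}
    (hΦ : ∀ x y, dist (Φ x) (Φ y) ^ 2 = ‖x - y‖ ^ 2 + (g x - g y) ^ 2)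
    (hΦm : MeasurableEmbedding Φ) {B : Set (EuclideanSpace ℝ (Fin m))} (hB : IsOpen B)
    (hg : ContDiffOn ℝ 1 g B) :
    (Measure.euclideanHausdorffMeasure m).restrict (Φ '' B) =
      ((volume.restrict B).withDensity fun x => ENNReal.ofReal (graphArea g x)).map Φ := by
  set μ₁ := (Measure.euclideanHausdorffMeasure m).comap Φ
  set ν := (volume : Measure (EuclideanSpace ℝ (Fin m))).withDensity
    fun x => ENNReal.ofReal (graphArea g x) with hν
  have hloc : ∀ κ : ℝ≥0, 1 < κ → ∀ x ∈ B, ∃ N, IsOpen N ∧ x ∈ N ∧ ∀ A, MeasurableSet A →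
      A ⊆ N ∩ B → μ₁ A ≤ κ * ν A ∧ ν A ≤ κ * μ₁ A := fun κ hκ x hx => by
    obtain ⟨N, hN, hxN, h⟩ := exists_area_graph_le hΦ hΦm.injective
      (hg.contDiffAt (hB.mem_nhds hx)) hκ
    refine ⟨N, hN, hxN, fun A hA hAN => ?_⟩
    rw [hΦm.comap_apply, withDensity_apply _ hA]
    exact h A hA (hAN.trans inter_subset_left)
  have hle : ∀ κ : ℝ≥0, 1 < κ → μ₁.restrict B ≤ ((κ : ℝ≥0∞) • ν).restrict B := fun κ hκ =>
    restrict_le_of_forall_nhdsWithin (fun x hx => by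
      obtain ⟨N, hN, hxN, h⟩ := hloc κ hκ x hx
      exact ⟨N, hN, hxN, fun A hA hAN => (h A hA hAN).1⟩) hB.measurableSet
  have hge : ∀ κ : ℝ≥0, 1 < κ → ν.restrict B ≤ ((κ : ℝ≥0∞) • μ₁).restrict B := fun κ hκ =>
    restrict_le_of_forall_nhdsWithin (fun x hx => by
      obtain ⟨N, hN, hxN, h⟩ := hloc κ hκ x hx
      exact ⟨N, hN, hxN, fun A hA hAN => (h A hA hAN).2⟩) hB.measurableSet
  have heq : μ₁.restrict B = ν.restrict B := by
    refine le_antisymm (Measure.le_iff'.2 fun A => ?_) (Measure.le_iff'.2 fun A => ?_)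
    · refine ENNReal.le_of_forall_one_lt_le_mul fun κ hκ => ?_
      simpa [Measure.restrict_smul] using hle κ hκ A
    · refine ENNReal.le_of_forall_one_lt_le_mul fun κ hκ => ?_
      simpa [Measure.restrict_smul] using hge κ hκ A
  rw [← restrict_withDensity hB.measurableSet, ← hν, ← heq]
  conv_rhs => rw [← preimage_image_eq B hΦm.injective]
  rw [← hΦm.restrict_map, hΦm.map_comap, Measure.restrict_restrict
    (hΦm.measurableSet_image.2 hB.measurableSet), inter_eq_left.2 (image_subset_range _ _)]

end Area

/-! ### Smooth boundaries -/

section Boundary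

variable {n : ℕ} {W : Set (EuclideanSpace ℝ (Fin n))} {y : EuclideanSpace ℝ (Fin n)}
  {ρ : EuclideanSpace ℝ (Fin n) → ℝ}

theorem IsDefiningFun.contDiffAt (h : IsDefiningFun W y ρ) : ContDiffAt ℝ ∞ ρ y := by
  obtain ⟨⟨N, hN, hy, hρ, -⟩, -⟩ := h
  exact hρ.contDiffAt (hN.mem_nhds hy)

theorem IsDefiningFun.eventually_iff (h : IsDefiningFun W y ρ) : ∀ᶠ z in 𝓝 y, (z ∈ W ↔ ρ z < 0) := by
  obtain ⟨⟨N, hN, hy, -, hW⟩, -⟩ := h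
  filter_upwards [hN.mem_nhds hy] with z hz using hW z hz

theorem eq_zero_of_mem_frontier (hW : IsOpen W) (hy : y ∈ frontier W)
    (hρ : ContinuousAt ρ y) (h : ∀ᶠ z in 𝓝 y, (z ∈ W ↔ ρ z < 0)) : ρ y = 0 := by
  rw [hW.frontier_eq] at hy
  refine le_antisymm ?_ (not_lt.1 fun hlt => hy.2 (h.self_of_nhds.2 hlt))
  by_contra! hpos
  have := (hρ.eventually_const_lt hpos).and h
  obtain ⟨z, hz, hzW⟩ := (mem_closure_iff_frequently.1 hy.1).and_eventually this |>.exists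
  linarith [hzW.2.1 hz, hzW.1]

theorem IsDefiningFun.apply_eq_zero (hW : IsOpen W) (hy : y ∈ frontier W)
    (h : IsDefiningFun W y ρ) : ρ y = 0 :=
  eq_zero_of_mem_frontier hW hy h.contDiffAt.continuousAt h.eventually_iff

/-- A direction entering `W` according to one defining function does not leave it according to
another. -/
theorem inner_nonpos_of_inner_neg {ρ₁ ρ₂ : EuclideanSpace ℝ (Fin n) → ℝ}
    {a b v : EuclideanSpace ℝ (Fin n)}
    (h₁ : ∀ᶠ z in 𝓝 y, (z ∈ W ↔ ρ₁ z < 0)) (h₂ : ∀ᶠ z in 𝓝 y, (z ∈ W ↔ ρ₂ z < 0))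
    (d₁ : HasGradientAt ρ₁ a y) (d₂ : HasGradientAt ρ₂ b y) (e₁ : ρ₁ y = 0) (e₂ : ρ₂ y = 0)
    (hv : ⟪a, v⟫ < 0) : ⟪b, v⟫ ≤ 0 := by
  have hline : HasDerivAt (fun t : ℝ => y + t • v) v 0 := by
    simpa using ((hasDerivAt_id (0 : ℝ)).smul_const v).const_add y
  have hy0 : y + (0 : ℝ) • v = y := by simp
  have D₁ : HasDerivAt (fun t : ℝ => ρ₁ (y + t • v)) ⟪a, v⟫ 0 := by
    have := d₁.hasFDerivAt
    rw [← hy0] at this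
    convert! this.comp_hasDerivAt (0 : ℝ) hline using 1
  have D₂ : HasDerivAt (fun t : ℝ => ρ₂ (y + t • v)) ⟪b, v⟫ 0 := by
    have := d₂.hasFDerivAt
    rw [← hy0] at this
    convert! this.comp_hasDerivAt (0 : ℝ) hline using 1
  have hcont : Tendsto (fun t : ℝ => y + t • v) (𝓝[>] 0) (𝓝 y) := by
    have := hline.continuousAt.tendsto
    rw [hy0] at this
    exact this.mono_left nhdsWithin_le_nhds
  have s₁ := (hasDerivAt_iff_tendsto_slope.1 D₁).mono_left
    (nhdsWithin_mono 0 (show Ioi (0 : ℝ) ⊆ {0}ᶜ from fun t ht => ne_of_gt ht))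
  have s₂ := (hasDerivAt_iff_tendsto_slope.1 D₂).mono_left
    (nhdsWithin_mono 0 (show Ioi (0 : ℝ) ⊆ {0}ᶜ from fun t ht => ne_of_gt ht))
  refine le_of_tendsto s₂ ?_
  filter_upwards [s₁.eventually_lt_const hv, hcont.eventually h₁, hcont.eventually h₂,
    self_mem_nhdsWithin] with t ht hw₁ hw₂ (hpos : 0 < t)
  simp only [slope, vsub_eq_sub, sub_zero, zero_smul, add_zero, e₁, e₂, smul_eq_mul] at ht ⊢
  have h1 : ρ₁ (y + t • v) < 0 := by
    by_contra! hge
    exact absurd ht (not_lt.2 (by positivity))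
  have h2 := hw₂.1 (hw₁.2 h1)
  exact mul_nonpos_of_nonneg_of_nonpos (by positivity) h2.le

/-- The normalized gradient of a local defining function depends only on the set. -/
theorem normalized_gradient_unique {ρ₁ ρ₂ : EuclideanSpace ℝ (Fin n) → ℝ}
    {a b : EuclideanSpace ℝ (Fin n)}
    (h₁ : ∀ᶠ z in 𝓝 y, (z ∈ W ↔ ρ₁ z < 0)) (h₂ : ∀ᶠ z in 𝓝 y, (z ∈ W ↔ ρ₂ z < 0))
    (d₁ : HasGradientAt ρ₁ a y) (d₂ : HasGradientAt ρ₂ b y) (e₁ : ρ₁ y = 0) (e₂ : ρ₂ y = 0)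
    (ha : a ≠ 0) (hb : b ≠ 0) : ‖a‖⁻¹ • a = ‖b‖⁻¹ • b := by
  have ha' := norm_pos_iff.2 ha
  have hb' := norm_pos_iff.2 hb
  by_contra hne
  -- the direction `b / ‖b‖ - a / ‖a‖` would enter one of the half-spaces and leave the other
  have hlt : ⟪a, b⟫ < ‖a‖ * ‖b‖ := by
    refine lt_of_le_of_ne (real_inner_le_norm a b) fun h => hne ?_
    have := inner_eq_norm_mul_iff_real.1 h
    rw [inv_smul_eq_iff₀ ha'.ne', smul_comm, eq_inv_smul_iff₀ hb'.ne', this]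
  have key := inner_nonpos_of_inner_neg (v := ‖b‖⁻¹ • b - ‖a‖⁻¹ • a) h₁ h₂ d₁ d₂ e₁ e₂ (by
    rw [inner_sub_right, inner_smul_right, inner_smul_right, real_inner_self_eq_norm_sq]
    have : ‖b‖⁻¹ * ⟪a, b⟫ < ‖a‖ := by rw [inv_mul_lt_iff₀ hb']; linarith
    have h2 : ‖a‖⁻¹ * ‖a‖ ^ 2 = ‖a‖ := by field_simp
    linarith)
  rw [inner_sub_right, inner_smul_right, inner_smul_right, real_inner_self_eq_norm_sq,
    real_inner_comm] at key
  have : ‖a‖⁻¹ * ⟪a, b⟫ < ‖b‖ := by rw [inv_mul_lt_iff₀ ha']; exact hlt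
  have h2 : ‖b‖⁻¹ * ‖b‖ ^ 2 = ‖b‖ := by field_simp
  linarith

/-- The exterior normal may be computed from any differentiable local defining function with
nonzero gradient; smoothness of that function is not needed. -/
theorem unitExteriorNormal_eq (hW : IsOpen W) (hy : y ∈ frontier W)
    (hs : ∃ ρ, IsDefiningFun W y ρ) {a : EuclideanSpace ℝ (Fin n)}
    (h : ∀ᶠ z in 𝓝 y, (z ∈ W ↔ ρ z < 0)) (d : HasGradientAt ρ a y) (ha : a ≠ 0) :
    unitExteriorNormal W y = ‖a‖⁻¹ • a := by
  have hex : ∃ v, IsUnitExteriorNormal W y v := by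
    obtain ⟨ρ', hρ'⟩ := hs
    exact ⟨_, ρ', hρ', rfl⟩
  rw [unitExteriorNormal, dif_pos hex]
  obtain ⟨ρ', hρ', hv⟩ := hex.choose_spec
  rw [hv]
  exact normalized_gradient_unique hρ'.eventually_iff h
    (hρ'.contDiffAt.differentiableAt (by simp)).hasGradientAt d
    (hρ'.apply_eq_zero hW hy)
    (eq_zero_of_mem_frontier hW hy d.hasFDerivAt.continuousAt h) hρ'.2 ha

/-- A defining function at `y` is one at all nearby points. -/
theorem IsDefiningFun.eventually (h : IsDefiningFun W y ρ) : ∀ᶠ z in 𝓝 y, IsDefiningFun W z ρ := by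
  have hc := (continuousAt_gradient (h.contDiffAt.of_le (by simp))).eventually_ne h.2
  obtain ⟨⟨N, hN, hy, hρ, hW⟩, h0⟩ := h
  filter_upwards [hN.mem_nhds hy, hc] with z hz hz0 using ⟨⟨N, hN, hz, hρ, hW⟩, hz0⟩

theorem unitExteriorNormal_eq_of_isDefiningFun (hW : IsOpen W) (hy : y ∈ frontier W)
    (h : IsDefiningFun W y ρ) : unitExteriorNormal W y = ‖gradient ρ y‖⁻¹ • gradient ρ y :=
  unitExteriorNormal_eq hW hy ⟨ρ, h⟩ h.eventually_iff
    (h.contDiffAt.differentiableAt (by simp)).hasGradientAt h.2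

theorem continuousOn_unitExteriorNormal (hW : IsOpen W) (hs : HasSmoothBoundary W) :
    ContinuousOn (unitExteriorNormal W) (frontier W) := by
  intro y hy
  obtain ⟨ρ, hρ⟩ := hs y hy
  have hc : ContinuousAt (gradient ρ) y := continuousAt_gradient (hρ.contDiffAt.of_le (by simp))
  have hn : ‖gradient ρ y‖ ≠ 0 := norm_ne_zero_iff.2 hρ.2
  have : ContinuousAt (fun z => ‖gradient ρ z‖⁻¹ • gradient ρ z) y := by
    fun_prop (disch := assumption)
  refine this.continuousWithinAt.congr_of_eventuallyEq ?_
    (unitExteriorNormal_eq_of_isDefiningFun hW hy hρ)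
  filter_upwards [self_mem_nhdsWithin, hρ.eventually.filter_mono nhdsWithin_le_nhds] with z hz hz'
    using unitExteriorNormal_eq_of_isDefiningFun hW hz hz'

end Boundary

/-! ### The boundary as a graph in a transversal direction -/

section Graph

variable {m : ℕ}

/-- Isometric coordinates `(x, t) ∈ ℝᵐ × ℝ` on `ℝᵐ⁺¹` in which the unit vector `u` points in the
`t`-direction. -/
structure AxisCoord (m : ℕ) (u : EuclideanSpace ℝ (Fin (m + 1))) where
  /-- The coordinate map. -/
  toEquiv : (EuclideanSpace ℝ (Fin m) × ℝ) ≃L[ℝ] EuclideanSpace ℝ (Fin (m + 1))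
  measurePreserving : MeasurePreserving toEquiv
  inner_map : ∀ z z', ⟪toEquiv z, toEquiv z'⟫ = ⟪z.1, z'.1⟫ + z.2 * z'.2
  map_axis : toEquiv (0, 1) = u

/-- Such coordinates exist: compose any isometry `ℝᵐ × ℝ ≃ ℝᵐ⁺¹` with the reflection that carries
the image of the axis to `u`. -/
theorem exists_axisCoord {u : EuclideanSpace ℝ (Fin (m + 1))} (hu : ‖u‖ = 1) :
    Nonempty (AxisCoord m u) := by
  have hfr : Module.finrank ℝ (WithLp 2 (EuclideanSpace ℝ (Fin m) × ℝ)) = m + 1 := by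
    rw [(WithLp.linearEquiv 2 ℝ (EuclideanSpace ℝ (Fin m) × ℝ)).finrank_eq]
    simp
  let T₀ := ((stdOrthonormalBasis ℝ (WithLp 2 (EuclideanSpace ℝ (Fin m) × ℝ))).reindex
    (finCongr hfr)).repr
  set v := T₀ (WithLp.toLp 2 (0, 1)) with hv
  have hvu : ‖v‖ = ‖u‖ := by
    rw [hv, LinearIsometryEquiv.norm_map, hu, WithLp.prod_norm_eq_of_L2]
    simp
  let T := T₀.trans (Submodule.reflection (ℝ ∙ (v - u))ᗮ)
  refine ⟨⟨(WithLp.prodContinuousLinearEquiv 2 ℝ (EuclideanSpace ℝ (Fin m)) ℝ).symm.trans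
    T.toContinuousLinearEquiv, ?_, fun z z' => ?_, ?_⟩⟩
  · exact T.measurePreserving.comp (WithLp.volume_preserving_toLp _ _)
  · change ⟪T (WithLp.toLp 2 z), T (WithLp.toLp 2 z')⟫ = _
    rw [LinearIsometryEquiv.inner_map_map, WithLp.prod_inner_apply]
    simp [mul_comm]
  · exact Submodule.reflection_sub hvu

namespace AxisCoord

variable {u : EuclideanSpace ℝ (Fin (m + 1))} (S : AxisCoord m u)

theorem norm_sq_map (z : EuclideanSpace ℝ (Fin m) × ℝ) :
    ‖S.toEquiv z‖ ^ 2 = ‖z.1‖ ^ 2 + z.2 ^ 2 := by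
  rw [← real_inner_self_eq_norm_sq, S.inner_map, real_inner_self_eq_norm_sq, sq z.2]

theorem inner_map_axis (z : EuclideanSpace ℝ (Fin m) × ℝ) : ⟪S.toEquiv z, u⟫ = z.2 := by
  have := S.inner_map z (0, 1)
  rw [S.map_axis] at this
  simpa using this

/-- The parametrization `x ↦ (x, g x)` of the graph of `g`. -/
def graph (g : EuclideanSpace ℝ (Fin m) → ℝ) (x : EuclideanSpace ℝ (Fin m)) :
    EuclideanSpace ℝ (Fin (m + 1)) := S.toEquiv (x, g x)

theorem dist_graph (g : EuclideanSpace ℝ (Fin m) → ℝ) (x y : EuclideanSpace ℝ (Fin m)) :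
    dist (S.graph g x) (S.graph g y) ^ 2 = ‖x - y‖ ^ 2 + (g x - g y) ^ 2 := by
  rw [dist_eq_norm, graph, graph, ← map_sub, S.norm_sq_map]
  rfl

theorem measurableEmbedding_graph {g : EuclideanSpace ℝ (Fin m) → ℝ} (hg : Measurable g) :
    MeasurableEmbedding (S.graph g) := by
  refine Measurable.measurableEmbedding
    (S.toEquiv.continuous.measurable.comp (measurable_id.prodMk hg)) fun x y h => ?_
  exact congrArg Prod.fst (S.toEquiv.injective h)

/-- `W` is, inside `N`, the subgraph `{t < g x}` of a `C¹` function `g` of finite area on `B`. -/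
structure IsSubgraph (W N : Set (EuclideanSpace ℝ (Fin (m + 1))))
    (B : Set (EuclideanSpace ℝ (Fin m))) (g : EuclideanSpace ℝ (Fin m) → ℝ) : Prop where
  isOpen_N : IsOpen N
  isOpen_B : IsOpen B
  measurable : Measurable g
  contDiffOn : ContDiffOn ℝ 1 g B
  fst_mem : ∀ z, S.toEquiv z ∈ N → z.1 ∈ B
  mem_iff : ∀ z, S.toEquiv z ∈ N → (S.toEquiv z ∈ W ↔ z.2 < g z.1)
  area_lt_top : ∫⁻ x in B, ENNReal.ofReal (graphArea g x) < ⊤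

end AxisCoord

/-- The implicit function theorem: near a boundary point, `W` is a subgraph in every direction
along which a defining function increases. -/
theorem exists_isSubgraph {W : Set (EuclideanSpace ℝ (Fin (m + 1)))} (hW : IsOpen W)
    {y : EuclideanSpace ℝ (Fin (m + 1))} (hy : y ∈ frontier W)
    {ρ : EuclideanSpace ℝ (Fin (m + 1)) → ℝ} (hρ : IsDefiningFun W y ρ)
    {u : EuclideanSpace ℝ (Fin (m + 1))} (S : AxisCoord m u) (hu : 0 < ⟪gradient ρ y, u⟫) :
    ∃ N B g, y ∈ N ∧ S.IsSubgraph W N B g := by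
  set z₀ := S.toEquiv.symm y with hz₀
  have hSz₀ : S.toEquiv z₀ = y := S.toEquiv.apply_symm_apply y
  set r : EuclideanSpace ℝ (Fin m) × ℝ → ℝ := fun z => ρ (S.toEquiv z) with hr
  have hρ1 : ∀ᶠ z in 𝓝 y, ContDiffAt ℝ 1 ρ z :=
    (hρ.contDiffAt.of_le (by simp) : ContDiffAt ℝ 1 ρ y).eventually (by simp)
  have hcont : Tendsto S.toEquiv (𝓝 z₀) (𝓝 y) := hSz₀ ▸ S.toEquiv.continuous.tendsto z₀
  have hr1 : ∀ᶠ z in 𝓝 z₀, ContDiffAt ℝ 1 r z := by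
    filter_upwards [hcont.eventually hρ1] with z hz
    exact hz.comp z S.toEquiv.contDiff.contDiffAt
  have hr0 : ContDiffAt ℝ 1 r z₀ := hr1.self_of_nhds
  have hrz₀ : r z₀ = 0 := by rw [hr]; simpa [hSz₀] using hρ.apply_eq_zero hW hy
  have hslope : fderiv ℝ r z₀ (0, 1) = ⟪gradient ρ y, u⟫ := by
    have h1 : HasFDerivAt ρ (fderiv ℝ ρ y) (S.toEquiv z₀) := by
      rw [hSz₀]; exact (hρ.contDiffAt.differentiableAt (by simp)).hasFDerivAt
    have h2 := (h1.comp z₀ S.toEquiv.hasFDerivAt).fderiv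
    change fderiv ℝ r z₀ = _ at h2
    rw [h2, gradient, InnerProductSpace.toDual_symm_apply]
    simp [S.map_axis]
  have hinv : (fderiv ℝ r z₀ ∘L .inr ℝ (EuclideanSpace ℝ (Fin m)) ℝ).IsInvertible := by
    refine ⟨ContinuousLinearEquiv.unitsEquivAut ℝ (Units.mk0 _ hu.ne'), ?_⟩
    ext
    simp [hslope]
  -- the implicit function `ψ` is cut off outside `B` only to make it globally measurable
  set ψ := hr0.implicitFunction one_ne_zero hinv with hψ
  have hψ0 : ψ z₀.1 = z₀.2 := hr0.implicitFunction_apply_self one_ne_zero hinv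
  have hψd : ContDiffAt ℝ 1 ψ z₀.1 := hr0.contDiffAt_implicitFunction one_ne_zero hinv
  have hψr : ∀ᶠ x in 𝓝 z₀.1, r (x, ψ x) = 0 := by
    simpa [hrz₀] using hr0.eventually_apply_implicitFunction one_ne_zero hinv
  have hpos : ∀ᶠ z in 𝓝 z₀, 0 < fderiv ℝ r z (0, 1) := by
    have : ContinuousAt (fun z => fderiv ℝ r z (0, 1)) z₀ :=
      (hr0.continuousAt_fderiv one_ne_zero).clm_apply continuousAt_const
    exact this.eventually_const_lt (hslope.symm ▸ hu : 0 < fderiv ℝ r z₀ (0, 1))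
  obtain ⟨δ, hδ, hball⟩ := Metric.eventually_nhds_iff_ball.1
    (hr1.and (hpos.and (hcont.eventually hρ.eventually_iff)))
  have hbp : ∀ x ∈ ball z₀.1 δ, ∀ t ∈ ball z₀.2 δ, (x, t) ∈ ball z₀ δ := fun x hx t ht => by
    rw [← Prod.mk.eta (p := z₀), ← ball_prod_same]; exact ⟨hx, ht⟩
  have hmem : ∀ᶠ x in 𝓝 z₀.1, ψ x ∈ ball z₀.2 δ :=
    hψd.continuousAt.eventually (by rw [hψ0]; exact ball_mem_nhds _ hδ)
  have harea : ∀ᶠ x in 𝓝 z₀.1, graphArea ψ x < graphArea ψ z₀.1 + 1 :=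
    (continuousAt_graphArea hψd).eventually_lt_const (lt_add_one _)
  obtain ⟨B, hB, hBo, hx₀B⟩ := _root_.eventually_nhds_iff.1
    ((hψd.eventually (by simp)).and (hψr.and (hmem.and (harea.and
      (ball_mem_nhds z₀.1 hδ : ∀ᶠ x in 𝓝 z₀.1, x ∈ ball z₀.1 δ)))))
  have hψB : ContDiffOn ℝ 1 ψ B := fun x hx => (hB x hx).1.contDiffWithinAt
  have hind : EqOn (B.indicator ψ) ψ B := eqOn_indicator
  refine ⟨S.toEquiv '' (B ×ˢ ball z₀.2 δ), B, B.indicator ψ, ⟨z₀, ⟨hx₀B, mem_ball_self hδ⟩, hSz₀⟩,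
    S.toEquiv.isOpenMap _ (hBo.prod isOpen_ball), hBo, ?_, hψB.congr hind, ?_, ?_, ?_⟩
  · classical
    rw [← piecewise_eq_indicator]
    exact hψB.continuousOn.measurable_piecewise continuousOn_const hBo.measurableSet
  · rintro z ⟨z', hz', hzz'⟩
    rw [← S.toEquiv.injective hzz']
    exact hz'.1
  · rintro z ⟨z', hz', hzz'⟩
    obtain ⟨hx, ht⟩ : z ∈ B ×ˢ ball z₀.2 δ := S.toEquiv.injective hzz' ▸ hz'
    obtain ⟨-, hrx, hψx, -, hxb⟩ := hB _ hx
    -- `r` increases along the axis and vanishes on the graph, so it is negative exactly below it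
    have hmono : StrictMonoOn (fun t => r (z.1, t)) (ball z₀.2 δ) := by
      have hder : ∀ t ∈ ball z₀.2 δ,
          HasDerivAt (fun t => r (z.1, t)) (fderiv ℝ r (z.1, t) (0, 1)) t := fun t ht => by
        have h1 := ((hball _ (hbp _ hxb t ht)).1.differentiableAt one_ne_zero).hasFDerivAt
        exact h1.comp_hasDerivAt t ((hasDerivAt_const t z.1).prodMk (hasDerivAt_id t))
      refine strictMonoOn_of_deriv_pos (convex_ball _ _)
        (fun t ht => (hder t ht).continuousAt.continuousWithinAt) fun t ht => ?_
      rw [isOpen_ball.interior_eq] at ht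
      rw [(hder t ht).deriv]
      exact (hball _ (hbp _ hxb t ht)).2.1
    rw [hind hx, (hball z (hbp _ hxb _ ht)).2.2, ← hmono.lt_iff_lt ht hψx]
    simp only [hrx]
    rfl
  · have hfin : volume B < ⊤ :=
      (measure_mono fun x hx => (hB x hx).2.2.2.2).trans_lt measure_ball_lt_top
    calc ∫⁻ x in B, ENNReal.ofReal (graphArea (B.indicator ψ) x)
        ≤ ∫⁻ x in B, ENNReal.ofReal (graphArea ψ z₀.1 + 1) := by
          refine setLIntegral_mono measurable_const fun x hx => ENNReal.ofReal_le_ofReal ?_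
          have : gradient (B.indicator ψ) x = gradient ψ x := by
            rw [gradient, gradient, (hind.eventuallyEq_of_mem (hBo.mem_nhds hx)).fderiv_eq]
          rw [graphArea, this]
          exact (hB x hx).2.2.2.1.le
      _ = ENNReal.ofReal (graphArea ψ z₀.1 + 1) * volume B := setLIntegral_const _ _
      _ < ⊤ := ENNReal.mul_lt_top ENNReal.ofReal_lt_top hfin

end Graph

/-! ### The divergence theorem over a subgraph, along the axis -/

section LocalDivergence

variable {m : ℕ} {u : EuclideanSpace ℝ (Fin (m + 1))} {S : AxisCoord m u}
  {W N : Set (EuclideanSpace ℝ (Fin (m + 1)))} {B : Set (EuclideanSpace ℝ (Fin m))}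
  {g : EuclideanSpace ℝ (Fin m) → ℝ}

namespace AxisCoord.IsSubgraph

theorem mem_frontier_iff (h : S.IsSubgraph W N B g) (hW : IsOpen W)
    {z : EuclideanSpace ℝ (Fin m) × ℝ} (hz : S.toEquiv z ∈ N) :
    S.toEquiv z ∈ frontier W ↔ z.2 = g z.1 := by
  have hSc : Continuous S.toEquiv := S.toEquiv.continuous
  have hgc : ContinuousAt (fun z' : EuclideanSpace ℝ (Fin m) × ℝ => g z'.1) z :=
    ContinuousAt.comp' (h.contDiffOn.continuousOn.continuousAt
      (h.isOpen_B.mem_nhds (h.fst_mem z hz))) continuousAt_fst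
  have hN : ∀ᶠ z' in 𝓝 z, S.toEquiv z' ∈ N :=
    hSc.continuousAt.eventually (h.isOpen_N.mem_nhds hz)
  have hcl : S.toEquiv z ∈ closure W ↔ z ∈ closure (S.toEquiv ⁻¹' W) :=
    Set.ext_iff.1 (S.toEquiv.toHomeomorph.preimage_closure W) z
  rw [hW.frontier_eq, Set.mem_sdiff, h.mem_iff z hz, not_lt, hcl]
  constructor
  · rintro ⟨hc, hle⟩
    refine le_antisymm ?_ hle
    by_contra! hlt
    have := ((mem_closure_iff_frequently.1 hc).and_eventually
      ((hgc.eventually_lt continuousAt_snd hlt).and hN)).exists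
    obtain ⟨z', hz', hlt', hzN⟩ := this
    exact absurd ((h.mem_iff z' hzN).1 hz') (not_lt.2 hlt'.le)
  · intro he
    refine ⟨?_, he.ge⟩
    -- approach the graph from below along the axis
    have ht : Tendsto (fun t : ℝ => (z.1, t)) (𝓝[<] z.2) (𝓝 z) := by
      have : ContinuousAt (fun t : ℝ => (z.1, t)) z.2 := by fun_prop
      exact this.tendsto.mono_left nhdsWithin_le_nhds
    refine mem_closure_of_tendsto ht ?_
    filter_upwards [ht.eventually hN, self_mem_nhdsWithin] with t htN (hlt : t < z.2)
    exact (h.mem_iff _ htN).2 (he ▸ hlt)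

theorem graph_mem_frontier (h : S.IsSubgraph W N B g) (hW : IsOpen W)
    {x : EuclideanSpace ℝ (Fin m)} (hx : S.graph g x ∈ N) : S.graph g x ∈ frontier W :=
  (h.mem_frontier_iff hW (z := (x, g x)) hx).2 rfl

theorem frontier_inter (h : S.IsSubgraph W N B g) (hW : IsOpen W) :
    frontier W ∩ N = S.graph g '' B ∩ N := by
  ext y
  obtain ⟨z, rfl⟩ := S.toEquiv.surjective y
  refine and_congr_left fun hz => ?_
  rw [h.mem_frontier_iff hW hz]
  constructor
  · intro he
    exact ⟨z.1, h.fst_mem z hz, by rw [AxisCoord.graph, ← he]⟩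
  · rintro ⟨x, -, hx⟩
    rw [← S.toEquiv.injective hx]

/-- The factor `⟪ν, u⟫` cancels the area element: weighted by it, the surface measure projects to
Lebesgue measure along `u`. -/
theorem inner_unitExteriorNormal (h : S.IsSubgraph W N B g) (hW : IsOpen W)
    (hs : HasSmoothBoundary W) {x : EuclideanSpace ℝ (Fin m)} (hx : S.graph g x ∈ N) :
    graphArea g x * ⟪unitExteriorNormal W (S.graph g x), u⟫ = 1 := by
  have hxB := h.fst_mem (x, g x) hx
  have hy := h.graph_mem_frontier hW hx
  set a := gradient g x with ha
  have hg : HasFDerivAt g (fderiv ℝ g x) x :=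
    ((h.contDiffOn.contDiffAt (h.isOpen_B.mem_nhds hxB)).differentiableAt one_ne_zero).hasFDerivAt
  -- `t - g x` is a defining function in the coordinates `(x, t)`
  set ρ : EuclideanSpace ℝ (Fin (m + 1)) → ℝ :=
    fun y => (S.toEquiv.symm y).2 - g (S.toEquiv.symm y).1 with hρ
  have hev : ∀ᶠ y in 𝓝 (S.graph g x), (y ∈ W ↔ ρ y < 0) := by
    filter_upwards [h.isOpen_N.mem_nhds hx] with y hyN
    obtain ⟨z, rfl⟩ := S.toEquiv.surjective y
    rw [h.mem_iff z hyN, hρ]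
    simp
  have hd : HasGradientAt ρ (S.toEquiv (-a, 1)) (S.graph g x) := by
    have hsymm : HasFDerivAt S.toEquiv.symm _ (S.graph g x) := S.toEquiv.symm.hasFDerivAt
    have h1 := (hasFDerivAt_snd (𝕜 := ℝ) (p := S.toEquiv.symm (S.graph g x))).comp _ hsymm
    have hg' : HasFDerivAt g (fderiv ℝ g x) (S.toEquiv.symm (S.graph g x)).1 := by
      rw [AxisCoord.graph, ContinuousLinearEquiv.symm_apply_apply]; exact hg
    have h2 := (hg'.comp _ (hasFDerivAt_fst (𝕜 := ℝ)
      (p := S.toEquiv.symm (S.graph g x)))).comp _ hsymm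
    have h3 := h1.sub h2
    rw [hasGradientAt_iff_hasFDerivAt]
    refine h3.congr_fderiv ?_
    ext v
    obtain ⟨z, rfl⟩ := S.toEquiv.surjective v
    have : fderiv ℝ g x z.1 = ⟪a, z.1⟫ := by
      rw [ha, gradient, InnerProductSpace.toDual_symm_apply]
    simp [S.inner_map, this]
    ring
  have hnorm : ‖S.toEquiv (-a, 1)‖ = graphArea g x := by
    rw [graphArea, eq_comm, Real.sqrt_eq_iff_mul_self_eq (by positivity) (norm_nonneg _), ← sq,
      S.norm_sq_map]
    simp [ha, add_comm]
  have hne : S.toEquiv (-a, 1) ≠ 0 := by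
    rw [← norm_pos_iff, hnorm]; exact graphArea_pos g x
  rw [unitExteriorNormal_eq hW hy (hs _ hy) hev hd hne, inner_smul_left, S.inner_map_axis, hnorm]
  simp [(graphArea_pos g x).ne']

theorem restrict_surface (h : S.IsSubgraph W N B g) :
    (Measure.euclideanHausdorffMeasure m).restrict (S.graph g '' B) =
      ((volume.restrict B).withDensity fun x => ENNReal.ofReal (graphArea g x)).map (S.graph g) :=
  restrict_image_graph_eq_map (S.dist_graph g) (S.measurableEmbedding_graph h.measurable)
    h.isOpen_B h.contDiffOn

theorem surface_lt_top (h : S.IsSubgraph W N B g) (hW : IsOpen W) :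
    Measure.euclideanHausdorffMeasure m (frontier W ∩ N) < ⊤ := by
  rw [h.frontier_inter hW]
  refine (measure_mono inter_subset_left).trans_lt ?_
  rw [← Measure.restrict_apply_univ, h.restrict_surface,
    (S.measurableEmbedding_graph h.measurable).map_apply, withDensity_apply _ (by measurability)]
  simpa using h.area_lt_top

variable {F : Type*} [NormedAddCommGroup F] [NormedSpace ℝ F]

/-- The flux of `φ u` through the boundary, as an integral over the base of the graph. -/
theorem setIntegral_surface (h : S.IsSubgraph W N B g) (hW : IsOpen W)
    (hs : HasSmoothBoundary W) {φ : EuclideanSpace ℝ (Fin (m + 1)) → F} (hφN : tsupport φ ⊆ N) :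
    ∫ y in frontier W, ⟪unitExteriorNormal W y, u⟫ • φ y ∂(Measure.euclideanHausdorffMeasure m) =
      ∫ x, φ (S.graph g x) := by
  have hφ0 : ∀ y, y ∉ N → φ y = 0 := fun y hy =>
    image_eq_zero_of_notMem_tsupport fun h => hy (hφN h)
  have hemb := S.measurableEmbedding_graph h.measurable
  have himg : MeasurableSet (S.graph g '' B) :=
    hemb.measurableSet_image.2 h.isOpen_B.measurableSet
  have hN := h.isOpen_N.measurableSet
  have e1 : ∀ A : Set (EuclideanSpace ℝ (Fin (m + 1))), MeasurableSet A →
      ∫ y in A, ⟪unitExteriorNormal W y, u⟫ • φ y ∂(Measure.euclideanHausdorffMeasure m) =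
      ∫ y in A ∩ N, ⟪unitExteriorNormal W y, u⟫ • φ y ∂(Measure.euclideanHausdorffMeasure m) :=
    fun A hA => setIntegral_eq_of_subset_of_forall_sdiff_eq_zero hA inter_subset_left
      fun y hy => by rw [hφ0 y fun hyN => hy.2 ⟨hy.1, hyN⟩, smul_zero]
  have e2 : ∫ x in B, φ (S.graph g x) = ∫ x, φ (S.graph g x) :=
    setIntegral_eq_integral_of_forall_compl_eq_zero fun x hx =>
      hφ0 _ fun hN => hx (h.fst_mem (x, g x) hN)
  rw [e1 _ isClosed_frontier.measurableSet, h.frontier_inter hW, ← e1 _ himg, h.restrict_surface,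
    hemb.integral_map, integral_withDensity_eq_integral_toReal_smul
      (measurable_graphArea g).ennreal_ofReal (by simp), ← e2]
  refine integral_congr_ae (ae_of_all _ fun x => ?_)
  by_cases hx : S.graph g x ∈ N
  · simp only
    rw [ENNReal.toReal_ofReal (graphArea_pos g x).le, smul_smul,
      h.inner_unitExteriorNormal hW hs hx, one_smul]
  · simp [hφ0 _ hx]

/-- The integral of `∂_u φ` over the subgraph, by Fubini and the fundamental theorem of calculus on
the lines parallel to `u`. -/
theorem setIntegral_volume [CompleteSpace F] (h : S.IsSubgraph W N B g) (hW : IsOpen W)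
    {φ : EuclideanSpace ℝ (Fin (m + 1)) → F} (hφ : ContDiff ℝ 1 φ) (hφc : HasCompactSupport φ)
    (hφN : tsupport φ ⊆ N) :
    ∫ y in W, fderiv ℝ φ y u = ∫ x, φ (S.graph g x) := by
  have hfc : Continuous fun y => fderiv ℝ φ y u :=
    (hφ.continuous_fderiv one_ne_zero).clm_apply continuous_const
  have hfs : HasCompactSupport fun y => fderiv ℝ φ y u :=
    (hφc.fderiv (𝕜 := ℝ)).comp_left (g := fun L : _ →L[ℝ] F => L u) rfl
  have hint : Integrable (W.indicator fun y => fderiv ℝ φ y u) :=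
    (hfc.integrable_of_hasCompactSupport hfs).indicator hW.measurableSet
  have hemb : MeasurableEmbedding S.toEquiv := S.toEquiv.toHomeomorph.measurableEmbedding
  rw [← integral_indicator hW.measurableSet, ← S.measurePreserving.integral_comp hemb,
    Measure.volume_eq_prod, integral_prod]
  swap
  · rw [← Measure.volume_eq_prod]
    exact (S.measurePreserving.integrable_comp_emb hemb).2 hint
  refine integral_congr_ae (ae_of_all _ fun x => ?_)
  simp only
  set k : ℝ → F := fun t => φ (S.toEquiv (x, t)) with hk
  have hkd : ∀ t, HasDerivAt k (fderiv ℝ φ (S.toEquiv (x, t)) u) t := fun t => by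
    have h1 : HasDerivAt (fun t : ℝ => S.toEquiv (x, t)) u t := by
      have := S.toEquiv.hasFDerivAt.comp_hasDerivAt t
        ((hasDerivAt_const t x).prodMk (hasDerivAt_id t))
      rw [ContinuousLinearEquiv.coe_coe, S.map_axis] at this
      exact this
    exact ((hφ.differentiable one_ne_zero).differentiableAt.hasFDerivAt).comp_hasDerivAt t h1
  have hkc : ContDiff ℝ 1 k := by
    have : ContDiff ℝ 1 fun t : ℝ => S.toEquiv (x, t) :=
      S.toEquiv.contDiff.comp (contDiff_const.prodMk contDiff_id)
    exact hφ.comp this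
  have hks : HasCompactSupport k := by
    have hce : IsClosedEmbedding fun t : ℝ => S.toEquiv (x, t) :=
      S.toEquiv.toHomeomorph.isClosedEmbedding.comp
        (IsClosedEmbedding.of_continuous_injective_isClosedMap (by fun_prop)
          (fun a b hab => (Prod.mk.inj hab).2) (isClosedMap_prodMk_left x))
    exact hφc.comp_isClosedEmbedding hce
  have hind : (fun t => W.indicator (fun y => fderiv ℝ φ y u) (S.toEquiv (x, t))) =
      (Iio (g x)).indicator (deriv k) := by
    classical
    funext t
    rw [indicator_apply, indicator_apply, (hkd t).deriv]
    by_cases hN : S.toEquiv (x, t) ∈ N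
    · simp only [h.mem_iff _ hN, mem_Iio]
    · have : fderiv ℝ φ (S.toEquiv (x, t)) = 0 := by
        refine image_eq_zero_of_notMem_tsupport fun hmem => hN (hφN ?_)
        exact (tsupport_fderiv_subset ℝ) hmem
      simp [this]
  rw [hind, integral_indicator measurableSet_Iio, ← integral_Iic_eq_integral_Iio,
    HasCompactSupport.integral_Iic_deriv_eq hkc hks]
  rfl

end AxisCoord.IsSubgraph

end LocalDivergence

/-! ### The divergence theorem -/

section Divergence

variable {m : ℕ} {W : Set (EuclideanSpace ℝ (Fin (m + 1)))}
  {F : Type*} [NormedAddCommGroup F]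

theorem surface_lt_top (hW : IsOpen W) (hb : Bornology.IsBounded W) (hs : HasSmoothBoundary W) :
    Measure.euclideanHausdorffMeasure m (frontier W) < ⊤ := by
  have hc : IsCompact (frontier W) :=
    hb.isCompact_closure.of_isClosed_subset isClosed_frontier frontier_subset_closure
  refine hc.measure_lt_top_of_nhdsWithin fun y hy => ?_
  obtain ⟨ρ, hρ⟩ := hs y hy
  have hn := norm_pos_iff.2 hρ.2
  obtain ⟨S⟩ := exists_axisCoord (u := ‖gradient ρ y‖⁻¹ • gradient ρ y)
    (by rw [norm_smul, norm_inv, norm_norm, inv_mul_cancel₀ hn.ne'])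
  obtain ⟨N, B, g, hyN, h⟩ := exists_isSubgraph hW hy hρ S (by
    rw [inner_smul_right, real_inner_self_eq_norm_sq]; positivity)
  exact ⟨frontier W ∩ N, inter_mem_nhdsWithin _ (h.isOpen_N.mem_nhds hyN), h.surface_lt_top hW⟩

theorem integrableOn_frontier (hW : IsOpen W) (hb : Bornology.IsBounded W)
    (hs : HasSmoothBoundary W) {φ : EuclideanSpace ℝ (Fin (m + 1)) → F}
    (hφ : ContinuousOn φ (frontier W)) :
    IntegrableOn φ (frontier W) (Measure.euclideanHausdorffMeasure m) := by
  have hc : IsCompact (frontier W) :=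
    hb.isCompact_closure.of_isClosed_subset isClosed_frontier frontier_subset_closure
  obtain ⟨C, hC⟩ := hc.exists_bound_of_continuousOn hφ
  exact IntegrableOn.of_bound (surface_lt_top hW hb hs)
    (hφ.aestronglyMeasurable isClosed_frontier.measurableSet) C
    ((ae_restrict_iff' isClosed_frontier.measurableSet).2 (ae_of_all _ hC))

variable [NormedSpace ℝ F]

/-- The identity `∫_W ∂_v φ = ∫_{∂W} ⟪ν, v⟫ φ dS`. -/
def DivergenceIdentity (W : Set (EuclideanSpace ℝ (Fin (m + 1))))
    (φ : EuclideanSpace ℝ (Fin (m + 1)) → F) (v : EuclideanSpace ℝ (Fin (m + 1))) : Prop :=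
  ∫ y in W, fderiv ℝ φ y v = ∫ y in frontier W, ⟪unitExteriorNormal W y, v⟫ • φ y
    ∂(Measure.euclideanHausdorffMeasure m)

theorem DivergenceIdentity.smul {φ : EuclideanSpace ℝ (Fin (m + 1)) → F}
    {v : EuclideanSpace ℝ (Fin (m + 1))} (h : DivergenceIdentity W φ v) (c : ℝ) :
    DivergenceIdentity W φ (c • v) := by
  unfold DivergenceIdentity at *
  simp only [map_smul, inner_smul_right, mul_smul]
  rw [integral_smul, integral_smul, h]

theorem DivergenceIdentity.sub (hW : IsOpen W) (hb : Bornology.IsBounded W)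
    (hs : HasSmoothBoundary W) {φ : EuclideanSpace ℝ (Fin (m + 1)) → F} (hφ : ContDiff ℝ 1 φ)
    {v w : EuclideanSpace ℝ (Fin (m + 1))} (h : DivergenceIdentity W φ v)
    (h' : DivergenceIdentity W φ w) : DivergenceIdentity W φ (v - w) := by
  have hi : ∀ v, IntegrableOn (fun y => fderiv ℝ φ y v) W := fun v =>
    (((hφ.continuous_fderiv one_ne_zero).clm_apply continuous_const).continuousOn.integrableOn_compact
      hb.isCompact_closure).mono_set subset_closure
  have hn := continuousOn_unitExteriorNormal hW hs
  have hi' : ∀ v, IntegrableOn (fun y => ⟪unitExteriorNormal W y, v⟫ • φ y) (frontier W)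
      (Measure.euclideanHausdorffMeasure m) := fun v => by
    have := hφ.continuous
    exact integrableOn_frontier hW hb hs (by fun_prop)
  unfold DivergenceIdentity at *
  simp only [map_sub, inner_sub_right, sub_smul]
  rw [integral_sub (hi v) (hi w), integral_sub (hi' v) (hi' w), h, h']

theorem exists_divergenceIdentity_of_transversal [CompleteSpace F] (hW : IsOpen W)
    (hs : HasSmoothBoundary W) {y v : EuclideanSpace ℝ (Fin (m + 1))} (hy : y ∈ frontier W)
    {ρ : EuclideanSpace ℝ (Fin (m + 1)) → ℝ} (hρ : IsDefiningFun W y ρ)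
    (hv : 0 < ⟪gradient ρ y, v⟫) :
    ∃ N, IsOpen N ∧ y ∈ N ∧ ∀ φ : EuclideanSpace ℝ (Fin (m + 1)) → F, ContDiff ℝ 1 φ →
      HasCompactSupport φ → tsupport φ ⊆ N → DivergenceIdentity W φ v := by
  have hv0 : v ≠ 0 := fun h => by simp [h] at hv
  have hn := norm_pos_iff.2 hv0
  obtain ⟨S⟩ := exists_axisCoord (u := ‖v‖⁻¹ • v)
    (by rw [norm_smul, norm_inv, norm_norm, inv_mul_cancel₀ hn.ne'])
  obtain ⟨N, B, g, hyN, h⟩ := exists_isSubgraph hW hy hρ S (by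
    rw [inner_smul_right]; positivity)
  refine ⟨N, h.isOpen_N, hyN, fun φ hφ hφc hφN => ?_⟩
  have : DivergenceIdentity W φ (‖v‖⁻¹ • v) :=
    (h.setIntegral_volume hW hφ hφc hφN).trans (h.setIntegral_surface hW hs hφN).symm
  simpa [smul_smul, hn.ne'] using this.smul ‖v‖

theorem integral_fderiv_eq_zero [CompleteSpace F] {φ : EuclideanSpace ℝ (Fin (m + 1)) → F}
    (hφ : ContDiff ℝ 1 φ) (hφc : HasCompactSupport φ) (v : EuclideanSpace ℝ (Fin (m + 1))) :
    ∫ y, fderiv ℝ φ y v = 0 := by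
  have hfc : Continuous fun y => fderiv ℝ φ y v :=
    (hφ.continuous_fderiv one_ne_zero).clm_apply continuous_const
  have hfs : HasCompactSupport fun y => fderiv ℝ φ y v :=
    (hφc.fderiv (𝕜 := ℝ)).comp_left (g := fun L : _ →L[ℝ] F => L v) rfl
  have := integral_bilinear_hasLineDerivAt_right_eq_neg_left_of_integrable (μ := volume)
    (f := fun _ : EuclideanSpace ℝ (Fin (m + 1)) => (1 : ℝ)) (f' := fun _ => 0) (g := φ)
    (g' := fun y => fderiv ℝ φ y v) (v := v) (B := ContinuousLinearMap.lsmul ℝ ℝ)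
    (by simp) (by simpa using hfc.integrable_of_hasCompactSupport hfs)
    (by simpa using hφ.continuous.integrable_of_hasCompactSupport hφc)
    (fun x _ => by simpa [HasLineDerivAt] using hasDerivAt_const (0 : ℝ) (1 : ℝ))
    (fun x _ => ((hφ.differentiable one_ne_zero) x).hasFDerivAt.hasLineDerivAt v)
  simpa using this

/-- The divergence theorem for functions supported near a given point. Every direction, even a
tangential one, is a difference of two directions transversal to the boundary. -/
theorem exists_divergenceIdentity [CompleteSpace F] (hW : IsOpen W) (hb : Bornology.IsBounded W)
    (hs : HasSmoothBoundary W) {y : EuclideanSpace ℝ (Fin (m + 1))} (hy : y ∈ closure W)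
    (v : EuclideanSpace ℝ (Fin (m + 1))) :
    ∃ N, IsOpen N ∧ y ∈ N ∧ ∀ φ : EuclideanSpace ℝ (Fin (m + 1)) → F, ContDiff ℝ 1 φ →
      HasCompactSupport φ → tsupport φ ⊆ N → DivergenceIdentity W φ v := by
  by_cases hyW : y ∈ W
  · refine ⟨W, hW, hyW, fun φ hφ hφc hφW => ?_⟩
    have e1 : ∫ y in W, fderiv ℝ φ y v = 0 := by
      rw [setIntegral_eq_integral_of_forall_compl_eq_zero, integral_fderiv_eq_zero hφ hφc]
      intro x hx
      have : fderiv ℝ φ x = 0 :=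
        image_eq_zero_of_notMem_tsupport fun hmem => hx (hφW (tsupport_fderiv_subset ℝ hmem))
      simp [this]
    rw [DivergenceIdentity, e1, eq_comm]
    refine setIntegral_eq_zero_of_forall_eq_zero fun x hx => ?_
    rw [hW.frontier_eq] at hx
    rw [image_eq_zero_of_notMem_tsupport fun hmem => hx.2 (hφW hmem), smul_zero]
  · have hyf : y ∈ frontier W := by rw [hW.frontier_eq]; exact ⟨hy, hyW⟩
    obtain ⟨ρ, hρ⟩ := hs y hyf
    set a := gradient ρ y with ha
    have hn : 0 < ‖a‖ := norm_pos_iff.2 hρ.2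
    -- `v = (v + c a) - c a`, both terms being transversal to the boundary at `y`
    set c := (1 + |⟪a, v⟫|) / ‖a‖ ^ 2 with hc
    obtain ⟨N₁, hN₁, hy₁, h₁⟩ := exists_divergenceIdentity_of_transversal (F := F) hW hs hyf hρ
      (v := v + c • a) (by
        rw [inner_add_right, inner_smul_right, real_inner_self_eq_norm_sq, hc,
          div_mul_cancel₀ _ (by positivity)]
        linarith [neg_abs_le ⟪a, v⟫])
    obtain ⟨N₂, hN₂, hy₂, h₂⟩ := exists_divergenceIdentity_of_transversal (F := F) hW hs hyf hρ
      (v := a) (by rw [real_inner_self_eq_norm_sq]; positivity)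
    refine ⟨N₁ ∩ N₂, hN₁.inter hN₂, ⟨hy₁, hy₂⟩, fun φ hφ hφc hφN => ?_⟩
    simpa using (h₁ φ hφ hφc (hφN.trans inter_subset_left)).sub hW hb hs hφ
      ((h₂ φ hφ hφc (hφN.trans inter_subset_right)).smul c)

/-- The divergence theorem, for a bounded open set with smooth boundary and a function of class
`C¹` near its closure. -/
theorem divergenceIdentity [CompleteSpace F] (hW : IsOpen W) (hb : Bornology.IsBounded W)
    (hs : HasSmoothBoundary W) {V : Set (EuclideanSpace ℝ (Fin (m + 1)))} (hV : IsOpen V)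
    (hWV : closure W ⊆ V) {φ : EuclideanSpace ℝ (Fin (m + 1)) → F} (hφ : ContDiffOn ℝ 1 φ V)
    (v : EuclideanSpace ℝ (Fin (m + 1))) : DivergenceIdentity W φ v := by
  choose! N hNo hyN hN using fun y (hy : y ∈ closure W) =>
    exists_divergenceIdentity (F := F) hW hb hs hy v
  obtain ⟨t, htW, htc⟩ := hb.isCompact_closure.elim_nhds_subcover N
    fun y hy => (hNo y hy).mem_nhds (hyN y hy)
  obtain ⟨R, hR⟩ := hb.isCompact_closure.isBounded.subset_ball 0
  obtain ⟨χ, hχ⟩ := SmoothPartitionOfUnity.exists_isSubordinate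
    (modelWithCornersSelf ℝ (EuclideanSpace ℝ (Fin (m + 1)))) isClosed_closure
    (fun i : t => N i ∩ (V ∩ ball 0 R))
    (fun i => (hNo i (htW i i.2)).inter (hV.inter isOpen_ball)) (fun y hy => by
      obtain ⟨i, hi, hyi⟩ := mem_iUnion₂.1 (htc hy)
      exact mem_iUnion.2 ⟨⟨i, hi⟩, hyi, hWV hy, hR hy⟩)
  set ψ : t → EuclideanSpace ℝ (Fin (m + 1)) → F := fun i y => χ i y • φ y with hψ
  have hts : ∀ i, tsupport (ψ i) ⊆ tsupport (χ i) := fun i => tsupport_smul_subset_left _ _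
  have hψd : ∀ i, ContDiff ℝ 1 (ψ i) := fun i => contDiff_iff_contDiffAt.2 fun y => by
    by_cases hy : y ∈ tsupport (ψ i)
    swap
    · exact contDiffAt_const.congr_of_eventuallyEq (notMem_tsupport_iff_eventuallyEq.1 hy)
    have hyV := (hχ i (hts i hy)).2.1
    have h1 : ContDiff ℝ 1 (χ i) := (χ i).contMDiff.contDiff.of_le (by simp)
    exact h1.contDiffAt.smul (hφ.contDiffAt (hV.mem_nhds hyV))
  have hψc : ∀ i, HasCompactSupport (ψ i) := fun i =>
    (isCompact_closedBall 0 R).of_isClosed_subset (isClosed_tsupport _)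
      fun y hy => ball_subset_closedBall (hχ i (hts i hy)).2.2
  have hid : ∀ i, DivergenceIdentity W (ψ i) v := fun i =>
    hN i (htW i i.2) _ (hψd i) (hψc i) fun y hy => (hχ i (hts i hy)).1
  have hsum : ∀ y ∈ closure W, φ y = ∑ i, ψ i y := fun y hy => by
    have := χ.sum_eq_one hy
    rw [finsum_eq_sum_of_fintype] at this
    simp only [hψ, ← Finset.sum_smul, this, one_smul]
  have hder : ∀ y ∈ W, fderiv ℝ φ y v = ∑ i, fderiv ℝ (ψ i) y v := fun y hy => by
    have : φ =ᶠ[𝓝 y] fun y => ∑ i, ψ i y := by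
      filter_upwards [hW.mem_nhds hy] with z hz using hsum z (subset_closure hz)
    rw [this.fderiv_eq, fderiv_fun_sum fun i _ => (hψd i).differentiable one_ne_zero y]
    simp
  have hn := continuousOn_unitExteriorNormal hW hs
  rw [DivergenceIdentity, setIntegral_congr_fun hW.measurableSet hder, integral_finsetSum,
    setIntegral_congr_fun (g := fun y => ∑ i, ⟪unitExteriorNormal W y, v⟫ • ψ i y)
      isClosed_frontier.measurableSet, integral_finsetSum]
  · exact Finset.sum_congr rfl fun i _ => hid i
  · intro i _
    have := (hψd i).continuous
    exact integrableOn_frontier hW hb hs (by fun_prop)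
  · intro y hy
    simp only [hsum y (frontier_subset_closure hy), Finset.smul_sum]
  · exact fun i _ => ((((hψd i).continuous_fderiv one_ne_zero).clm_apply
      continuous_const).continuousOn.integrableOn_compact hb.isCompact_closure).mono_set
        subset_closure

end Divergence

/-! ### Regularized radial kernels -/

section Radial

theorem hasDerivAt_inv_sqrt_pow (k : ℕ) {u : ℝ} (hu : 0 < u) :
    HasDerivAt (fun u => (√u ^ (k + 1))⁻¹) (-((k + 1 : ℝ) / 2) * (√u ^ (k + 3))⁻¹) u := by
  have hs : 0 < √u := Real.sqrt_pos.2 hu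
  convert! ((Real.hasDerivAt_sqrt hu.ne').pow (k + 1)).inv (pow_ne_zero _ hs.ne') using 1
  simp only [Pi.pow_apply, Nat.add_sub_cancel]
  push_cast
  field_simp
  ring

variable {m : ℕ}

/-- The profile `(|z|² + ε²)^(-(m+1)/2)`, the power `|z|^(-(m+1))` regularized at the origin. For
`ε = 0` it is that power itself, with the value `0` at `z = 0`. -/
noncomputable def radial (m : ℕ) (ε : ℝ) (z : EuclideanSpace ℝ (Fin (m + 1))) : ℝ :=
  (√(‖z‖ ^ 2 + ε ^ 2) ^ (m + 1))⁻¹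

/-- The density `(m+1) ε² (|z|² + ε²)^(-(m+3)/2)`, which is `div (z (|z|² + ε²)^(-(m+1)/2))`. -/
noncomputable def peak (m : ℕ) (ε : ℝ) (z : EuclideanSpace ℝ (Fin (m + 1))) : ℝ :=
  (m + 1) * ε ^ 2 * (√(‖z‖ ^ 2 + ε ^ 2) ^ (m + 3))⁻¹

theorem radial_nonneg (ε : ℝ) (z : EuclideanSpace ℝ (Fin (m + 1))) : 0 ≤ radial m ε z := by
  unfold radial; positivity

theorem radial_zero (z : EuclideanSpace ℝ (Fin (m + 1))) : radial m 0 z = (‖z‖ ^ (m + 1))⁻¹ := by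
  simp [radial, Real.sqrt_sq]

/-- The factor `‖z‖` is needed at `z = 0`, where `radial m 0 z` is `0`. -/
theorem radial_mul_norm_le (ε : ℝ) (z : EuclideanSpace ℝ (Fin (m + 1))) :
    radial m ε z * ‖z‖ ≤ radial m 0 z * ‖z‖ := by
  rcases eq_or_ne z 0 with rfl | hz
  · simp
  · have h : ‖z‖ ≤ √(‖z‖ ^ 2 + ε ^ 2) := Real.le_sqrt_of_sq_le (by nlinarith [sq_nonneg ε])
    have := norm_pos_iff.2 hz
    rw [radial_zero, radial]
    gcongr

theorem measurable_radial (ε : ℝ) : Measurable (radial m ε) := by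
  unfold radial
  fun_prop

theorem hasFDerivAt_radial {ε : ℝ} (hε : ε ≠ 0) (z : EuclideanSpace ℝ (Fin (m + 1))) :
    HasFDerivAt (radial m ε)
      ((-(m + 1 : ℝ) * (√(‖z‖ ^ 2 + ε ^ 2) ^ (m + 3))⁻¹) • innerSL ℝ z) z := by
  have h1 : HasFDerivAt (fun z : EuclideanSpace ℝ (Fin (m + 1)) => ‖z‖ ^ 2 + ε ^ 2)
      (2 • innerSL ℝ z) z := (hasStrictFDerivAt_norm_sq z).hasFDerivAt.add_const _
  have h2 := (hasDerivAt_inv_sqrt_pow m (u := ‖z‖ ^ 2 + ε ^ 2) (by positivity)).comp_hasFDerivAt z h1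
  refine h2.congr_fderiv ?_
  ext v
  simp
  ring

theorem contDiff_radial {ε : ℝ} (hε : ε ≠ 0) {n : WithTop ℕ∞} : ContDiff ℝ n (radial m ε) := by
  have h0 : ∀ z : EuclideanSpace ℝ (Fin (m + 1)), ‖z‖ ^ 2 + ε ^ 2 ≠ 0 := fun z => by positivity
  unfold radial
  refine ContDiff.inv (ContDiff.pow (ContDiff.sqrt ((contDiff_norm_sq ℝ).add contDiff_const) h0) _)
    fun z => by positivity

theorem tendsto_radial {z : EuclideanSpace ℝ (Fin (m + 1))} (hz : z ≠ 0) :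
    Tendsto (fun ε => radial m ε z) (𝓝 0) (𝓝 (radial m 0 z)) := by
  have : √(‖z‖ ^ 2 + 0 ^ 2) ^ (m + 1) ≠ 0 := by
    have := norm_pos_iff.2 hz
    positivity
  have hc : ContinuousAt (fun ε => radial m ε z) 0 := by
    unfold radial
    fun_prop (disch := assumption)
  exact hc

/-- The kernel `|z|^(-(m+1)) |z| = |z|^(-m)` is locally integrable in `ℝᵐ⁺¹`. -/
theorem integrableOn_radial_mul_norm {W : Set (EuclideanSpace ℝ (Fin (m + 1)))}
    (hb : Bornology.IsBounded W) (a : EuclideanSpace ℝ (Fin (m + 1))) :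
    IntegrableOn (fun y => radial m 0 (y - a) * ‖y - a‖) W := by
  obtain ⟨R, hR⟩ := hb.subset_ball a
  have hball : IntegrableOn (fun z : EuclideanSpace ℝ (Fin (m + 1)) =>
      (fun r : ℝ => (r ^ (m + 1))⁻¹ * r) ‖z‖) (ball 0 R) := by
    refine (integrableOn_fun_norm_addHaar volume (f := fun r : ℝ => (r ^ (m + 1))⁻¹ * r)).2 ?_
    have : IntegrableOn (fun _ : ℝ => (1 : ℝ)) (Ioo 0 R) := by simp
    refine this.congr_fun (fun r hr => ?_) measurableSet_Ioo
    have := hr.1.ne'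
    simp only [finrank_euclideanSpace_fin, Nat.add_sub_cancel, smul_eq_mul]
    field_simp
    ring
  have htrans : IntegrableOn (fun y => radial m 0 (y - a) * ‖y - a‖) (ball a R) := by
    have hmp := measurePreserving_sub_right
      (volume : Measure (EuclideanSpace ℝ (Fin (m + 1)))) a
    have := (hmp.integrableOn_comp_preimage (measurableEmbedding_subRight a)
      (f := fun z : EuclideanSpace ℝ (Fin (m + 1)) => radial m 0 z * ‖z‖) (s := ball 0 R)).2
      (by simpa only [radial_zero] using hball)
    have hset : (fun y => y - a) ⁻¹' ball (0 : EuclideanSpace ℝ (Fin (m + 1))) R = ball a R := by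
      ext y
      simp [dist_eq_norm]
    rw [hset] at this
    exact this
  exact htrans.mono_set hR

/-- The mass of `peak` is the area of the unit sphere, `m + 1` times the volume of the ball. -/
theorem integral_peak (m : ℕ) : ∫ z, peak m 1 z =
    (m + 1) * volume.real (ball (0 : EuclideanSpace ℝ (Fin (m + 1))) 1) := by
  have h := integral_fun_norm_addHaar (volume : Measure (EuclideanSpace ℝ (Fin (m + 1))))
    (fun r : ℝ => (m + 1) * 1 ^ 2 * (√(r ^ 2 + 1 ^ 2) ^ (m + 3))⁻¹)
  have hone : ∫ r in Ioi (0 : ℝ), r ^ m * ((m + 1) * 1 ^ 2 * (√(r ^ 2 + 1 ^ 2) ^ (m + 3))⁻¹) = 1 := by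
    -- the primitive is `(r / √(r² + 1)) ^ (m + 1)`
    have hd : ∀ r : ℝ, HasDerivAt (fun r : ℝ => r ^ (m + 1) * (√(r ^ 2 + 1 ^ 2) ^ (m + 1))⁻¹)
        (r ^ m * ((m + 1) * 1 ^ 2 * (√(r ^ 2 + 1 ^ 2) ^ (m + 3))⁻¹)) r := fun r => by
      have h0 : 0 < r ^ 2 + 1 ^ 2 := by positivity
      have h1 := (hasDerivAt_inv_sqrt_pow m h0).comp r ((hasDerivAt_pow 2 r).add_const (1 ^ 2))
      convert! (hasDerivAt_pow (m + 1) r).mul h1 using 1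
      have hs := Real.sqrt_pos.2 h0
      have hsq : √(r ^ 2 + 1 ^ 2) ^ 2 = r ^ 2 + 1 ^ 2 := Real.sq_sqrt h0.le
      simp only [Function.comp_apply, Nat.add_sub_cancel]
      generalize √(r ^ 2 + 1 ^ 2) = s at hs hsq ⊢
      push_cast
      field_simp
      rw [show s ^ (m + 3) = s ^ (m + 1) * s ^ 2 by ring, hsq]
      ring
    have hlim : Tendsto (fun r : ℝ => r ^ (m + 1) * (√(r ^ 2 + 1 ^ 2) ^ (m + 1))⁻¹) atTop (𝓝 1) := by
      have h1 : Tendsto (fun r : ℝ => (√(1 + (r⁻¹) ^ 2) ^ (m + 1))⁻¹) atTop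
          (𝓝 ((√(1 + 0 ^ 2) ^ (m + 1))⁻¹)) := by
        have : √(1 + (0 : ℝ) ^ 2) ^ (m + 1) ≠ 0 := by simp
        have hc : ContinuousAt (fun t : ℝ => (√(1 + t ^ 2) ^ (m + 1))⁻¹) 0 := by
          fun_prop (disch := assumption)
        exact hc.tendsto.comp tendsto_inv_atTop_zero
      have h2 : (√(1 + (0 : ℝ) ^ 2) ^ (m + 1))⁻¹ = 1 := by simp
      rw [h2] at h1
      refine h1.congr' ?_
      filter_upwards [eventually_gt_atTop 0] with r hr
      have : √(r ^ 2 + 1 ^ 2) = r * √(1 + r⁻¹ ^ 2) := by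
        rw [Real.sqrt_eq_iff_mul_self_eq (by positivity) (by positivity), mul_mul_mul_comm,
          Real.mul_self_sqrt (by positivity)]
        field_simp
      rw [this, mul_pow, mul_inv, ← mul_assoc, mul_inv_cancel₀ (by positivity), one_mul]
    rw [integral_Ioi_of_hasDerivAt_of_nonneg' (fun r _ => hd r)
      (fun r (hr : 0 < r) => by positivity) hlim]
    simp
  simp only [finrank_euclideanSpace_fin, Nat.add_sub_cancel, smul_eq_mul, nsmul_eq_mul,
    hone] at h
  rw [show (∫ z, peak m 1 z) = _ from h]
  push_cast
  ring

theorem peak_inv (z : EuclideanSpace ℝ (Fin (m + 1))) {c : ℝ} (hc : 0 < c) :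
    peak m c⁻¹ z = c ^ (m + 1) * peak m 1 (c • z) := by
  have : √(‖c • z‖ ^ 2 + 1 ^ 2) = c * √(‖z‖ ^ 2 + c⁻¹ ^ 2) := by
    rw [Real.sqrt_eq_iff_mul_self_eq (by positivity) (by positivity), mul_mul_mul_comm,
      Real.mul_self_sqrt (by positivity), norm_smul, Real.norm_of_nonneg hc.le]
    field_simp
  rw [peak, peak, this]
  have h2 : 0 < √(‖z‖ ^ 2 + c⁻¹ ^ 2) := Real.sqrt_pos.2 (by positivity)
  generalize √(‖z‖ ^ 2 + c⁻¹ ^ 2) = s at h2 ⊢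
  field_simp
  ring

theorem tendsto_norm_pow_mul_peak (m : ℕ) :
    Tendsto (fun z : EuclideanSpace ℝ (Fin (m + 1)) => ‖z‖ ^ (m + 1) * peak m 1 z)
      (Bornology.cobounded _) (𝓝 0) := by
  have h1 : Tendsto (fun z : EuclideanSpace ℝ (Fin (m + 1)) => ((m : ℝ) + 1) * (‖z‖⁻¹) ^ 2)
      (Bornology.cobounded _) (𝓝 (((m : ℝ) + 1) * 0 ^ 2)) :=
    ((tendsto_inv_atTop_zero.comp tendsto_norm_cobounded_atTop).pow 2).const_mul _
  rw [zero_pow two_ne_zero, mul_zero] at h1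
  refine squeeze_zero' (Eventually.of_forall fun z => by unfold peak; positivity) ?_ h1
  filter_upwards [tendsto_norm_cobounded_atTop.eventually_gt_atTop 0] with z hz
  have h : ‖z‖ ≤ √(‖z‖ ^ 2 + 1 ^ 2) := Real.le_sqrt_of_sq_le (by nlinarith)
  calc ‖z‖ ^ (m + 1) * peak m 1 z ≤ ‖z‖ ^ (m + 1) * ((m + 1) * 1 ^ 2 * (‖z‖ ^ (m + 3))⁻¹) := by
        unfold peak; gcongr
    _ = _ := by field_simp; ring

/-- The densities `peak m c⁻¹` concentrate, as `c → ∞`, to a multiple of the Dirac mass. -/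
theorem tendsto_setIntegral_peak {F : Type*} [NormedAddCommGroup F] [NormedSpace ℝ F]
    [CompleteSpace F] {W : Set (EuclideanSpace ℝ (Fin (m + 1)))} (hW : IsOpen W)
    {g : EuclideanSpace ℝ (Fin (m + 1)) → F} (hg : IntegrableOn g W)
    {a : EuclideanSpace ℝ (Fin (m + 1))} (ha : a ∈ W) (hga : ContinuousAt g a) :
    Tendsto (fun c : ℝ => ∫ y in W, peak m c⁻¹ (y - a) • g y) atTop
      (𝓝 (((m + 1) * volume.real (ball (0 : EuclideanSpace ℝ (Fin (m + 1))) 1)) • g a)) := by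
  set s := (m + 1) * volume.real (ball (0 : EuclideanSpace ℝ (Fin (m + 1))) 1) with hs
  have hs0 : 0 < s := by
    have : 0 < volume.real (ball (0 : EuclideanSpace ℝ (Fin (m + 1))) 1) :=
      ENNReal.toReal_pos (measure_ball_pos _ _ one_pos).ne' measure_ball_lt_top.ne
    positivity
  have h1 := tendsto_integral_comp_smul_smul_of_integrable' (μ := volume)
    (φ := fun z : EuclideanSpace ℝ (Fin (m + 1)) => s⁻¹ * peak m 1 z) (g := W.indicator g) (x₀ := a)
    (fun z => by unfold peak; positivity)
    (by rw [integral_const_mul, integral_peak, inv_mul_cancel₀ hs0.ne'])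
    (by
      have := (tendsto_norm_pow_mul_peak m).const_mul s⁻¹
      rw [mul_zero] at this
      refine this.congr fun z => ?_
      rw [finrank_euclideanSpace_fin]; ring)
    (hg.integrable_indicator hW.measurableSet)
    (hga.congr (by filter_upwards [hW.mem_nhds ha] with z hz using (indicator_of_mem hz g).symm))
  rw [indicator_of_mem ha] at h1
  refine (h1.const_smul s).congr' ?_
  filter_upwards [eventually_gt_atTop 0] with c hc
  rw [← integral_smul, ← integral_indicator hW.measurableSet]
  refine integral_congr_ae (ae_of_all _ fun y => ?_)
  by_cases hy : y ∈ W
  · simp only [indicator_of_mem hy, finrank_euclideanSpace_fin]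
    have : peak m 1 (c • (a - y)) = peak m 1 (c • (y - a)) := by
      simp only [peak, norm_smul, norm_sub_rev a y]
    rw [peak_inv _ hc, smul_smul, this]
    congr 1
    field_simp
  · simp [indicator_of_notMem hy]

end Radial

/-! ### The Cauchy–Pompeiu formula for a factorization of the Laplacian -/

section CauchyPompeiu

variable {m : ℕ} {F : Type*} [NormedAddCommGroup F] [NormedSpace ℝ F]
  {eb e : EuclideanSpace ℝ (Fin (m + 1)) →L[ℝ] F →L[ℝ] F}
  {W V : Set (EuclideanSpace ℝ (Fin (m + 1)))} {g : EuclideanSpace ℝ (Fin (m + 1)) → F}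
  {a y : EuclideanSpace ℝ (Fin (m + 1))}

/-- The first-order operator `∑ᵢ e(bᵢ) ∂ᵢ` attached to a family of operators `e(v)` depending
linearly on `v`. -/
noncomputable def diracOp (e : EuclideanSpace ℝ (Fin (m + 1)) →L[ℝ] F →L[ℝ] F)
    (g : EuclideanSpace ℝ (Fin (m + 1)) → F) (y : EuclideanSpace ℝ (Fin (m + 1))) : F :=
  ∑ i, e (EuclideanSpace.single i 1) (fderiv ℝ g y (EuclideanSpace.single i 1))

theorem sum_smul_single (z : EuclideanSpace ℝ (Fin (m + 1))) :
    ∑ i, z i • EuclideanSpace.single i (1 : ℝ) = z := by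
  ext j
  simp [Finset.sum_apply, Pi.single_apply]

/-- The product rule `∑ᵢ ∂ᵢ (K e(bᵢ) g) = K (∑ᵢ e(bᵢ) ∂ᵢ g) + (∑ᵢ (∂ᵢ K) e(bᵢ)) g` for the regularized
kernel `K`. The last factor is a multiple of the identity, namely `peak`, because
`∑ᵢ ē(bᵢ) e(bᵢ) = m + 1` and `∑ᵢ zᵢ ē(z) e(bᵢ) = ē(z) e(z) = |z|²`. -/
theorem sum_fderiv_radial_smul (he : ∀ z v, eb z (e z v) = ‖z‖ ^ 2 • v) {ε : ℝ} (hε : ε ≠ 0)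
    (hg : DifferentiableAt ℝ g y) :
    ∑ i, fderiv ℝ (fun y => radial m ε (y - a) • eb (y - a) (e (EuclideanSpace.single i 1) (g y))) y
        (EuclideanSpace.single i 1) =
      radial m ε (y - a) • eb (y - a) (diracOp e g y) + peak m ε (y - a) • g y := by
  set z := y - a with hz
  set C := -(m + 1 : ℝ) * (√(‖z‖ ^ 2 + ε ^ 2) ^ (m + 3))⁻¹ with hC
  have hterm : ∀ i : Fin (m + 1), fderiv ℝ
      (fun y => radial m ε (y - a) • eb (y - a) (e (EuclideanSpace.single i 1) (g y))) y
        (EuclideanSpace.single i 1) =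
      radial m ε z • eb z (e (EuclideanSpace.single i 1)
        (fderiv ℝ g y (EuclideanSpace.single i 1))) + radial m ε z • g y +
      C • eb z (e (z i • EuclideanSpace.single i 1) (g y)) := fun i => by
    have hsub : HasFDerivAt (fun y => y - a) (ContinuousLinearMap.id ℝ _) y :=
      (hasFDerivAt_id y).sub_const a
    have h1 : HasFDerivAt (fun y => radial m ε (y - a)) (C • innerSL ℝ z) y := by
      have := (hasFDerivAt_radial hε (y - a)).comp y hsub
      rwa [ContinuousLinearMap.comp_id] at this
    have h2 := (eb.hasFDerivAt (x := z)).comp y hsub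
    have h3 := (e (EuclideanSpace.single i 1)).hasFDerivAt.comp y hg.hasFDerivAt
    have h4 := h1.smul (h2.clm_apply h3)
    refine (congrArg (fun L : _ →L[ℝ] F => L (EuclideanSpace.single i 1)) h4.fderiv).trans ?_
    simp only [_root_.add_apply, _root_.smul_apply,
      ContinuousLinearMap.smulRight_apply, ContinuousLinearMap.comp_apply,
      ContinuousLinearMap.flip_apply, Function.comp_apply, ContinuousLinearMap.id_apply,
      innerSL_apply_apply, EuclideanSpace.inner_single_right, he, map_smul, smul_add, ← hz]
    simp [smul_smul]
  rw [Finset.sum_congr rfl fun i _ => hterm i, Finset.sum_add_distrib, Finset.sum_add_distrib,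
    ← Finset.smul_sum, ← Finset.smul_sum, ← Finset.smul_sum, ← map_sum, ← map_sum]
  have hsum : ∑ i, e (z i • EuclideanSpace.single i 1) (g y) = e z (g y) := by
    rw [← _root_.sum_apply, ← map_sum, sum_smul_single]
  rw [hsum, he, add_assoc, diracOp]
  congr 1
  rw [Finset.sum_const, Finset.card_fin, ← Nat.cast_smul_eq_nsmul ℝ, smul_smul, smul_smul,
    ← add_smul]
  congr 1
  have hs : 0 < √(‖z‖ ^ 2 + ε ^ 2) := Real.sqrt_pos.2 (by positivity)
  have hsq : √(‖z‖ ^ 2 + ε ^ 2) ^ 2 = ‖z‖ ^ 2 + ε ^ 2 := Real.sq_sqrt (by positivity)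
  rw [hC, radial, peak]
  generalize √(‖z‖ ^ 2 + ε ^ 2) = s at hs hsq ⊢
  rw [eq_sub_of_add_eq' hsq.symm]
  push_cast
  field_simp
  ring

variable (e) in
theorem continuousOn_diracOp (hV : IsOpen V) (hg : ContDiffOn ℝ 1 g V) :
    ContinuousOn (diracOp e g) V := by
  have := hg.continuousOn_fderiv_of_isOpen hV le_rfl
  unfold diracOp
  fun_prop

/-- The divergence theorem applied to the fields `K e(bᵢ) g` with the smooth regularized kernel. -/
theorem regularized_cauchy_pompeiu [CompleteSpace F] (he : ∀ z v, eb z (e z v) = ‖z‖ ^ 2 • v)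
    (hW : IsOpen W) (hb : Bornology.IsBounded W)
    (hs : HasSmoothBoundary W) (hV : IsOpen V) (hWV : closure W ⊆ V) (hg : ContDiffOn ℝ 1 g V)
    (a : EuclideanSpace ℝ (Fin (m + 1))) {ε : ℝ} (hε : ε ≠ 0) :
    (∫ y in W, radial m ε (y - a) • eb (y - a) (diracOp e g y)) +
        ∫ y in W, peak m ε (y - a) • g y =
      ∫ y in frontier W, radial m ε (y - a) • eb (y - a) (e (unitExteriorNormal W y) (g y))
        ∂(Measure.euclideanHausdorffMeasure m) := by
  set φ : Fin (m + 1) → EuclideanSpace ℝ (Fin (m + 1)) → F := fun i y =>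
    radial m ε (y - a) • eb (y - a) (e (EuclideanSpace.single i 1) (g y)) with hφ
  have hr : ContDiff ℝ 1 (radial m ε) := contDiff_radial hε
  have hφd : ∀ i, ContDiffOn ℝ 1 (φ i) V := fun i => by
    have h1 : ContDiff ℝ 1 fun y => radial m ε (y - a) := hr.comp (contDiff_id.sub contDiff_const)
    have h2 : ContDiff ℝ 1 fun y => eb (y - a) := eb.contDiff.comp (contDiff_id.sub contDiff_const)
    exact h1.contDiffOn.smul (h2.contDiffOn.clm_apply
      ((e (EuclideanSpace.single i 1)).contDiff.comp_contDiffOn hg))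
  have hcl := hb.isCompact_closure
  have hint : ∀ {f : EuclideanSpace ℝ (Fin (m + 1)) → F}, ContinuousOn f V → IntegrableOn f W :=
    fun hf => ((hf.mono hWV).integrableOn_compact hcl).mono_set subset_closure
  have hgc : ContinuousOn g V := hg.continuousOn
  have hDc := continuousOn_diracOp e hV hg
  have hrc : Continuous (radial m ε) := hr.continuous
  have hpc : Continuous fun y => peak m ε (y - a) := by
    have h0 : ∀ y : EuclideanSpace ℝ (Fin (m + 1)), √(‖y - a‖ ^ 2 + ε ^ 2) ^ (m + 3) ≠ 0 :=
      fun y => (pow_pos (Real.sqrt_pos.2 (by positivity)) _).ne'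
    unfold peak
    fun_prop (disch := exact h0 _)
  have hpg : ContinuousOn (fun y => peak m ε (y - a) • g y) V := hpc.continuousOn.smul hgc
  rw [← integral_add (hint (by fun_prop)) (hint hpg),
    ← setIntegral_congr_fun hW.measurableSet fun y hy => sum_fderiv_radial_smul he hε
      ((hg.contDiffAt (hV.mem_nhds (hWV (subset_closure hy)))).differentiableAt one_ne_zero),
    integral_finsetSum _ fun i _ => hint
      (((hφd i).continuousOn_fderiv_of_isOpen hV le_rfl).clm_apply continuousOn_const)]
  have hn := continuousOn_unitExteriorNormal hW hs
  have hfV : frontier W ⊆ V := frontier_subset_closure.trans hWV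
  rw [Finset.sum_congr rfl fun i _ => divergenceIdentity hW hb hs hV hWV (hφd i) _,
    ← integral_finsetSum _ fun i _ => ?_]
  · refine setIntegral_congr_fun isClosed_frontier.measurableSet fun y hy => ?_
    simp only [hφ, EuclideanSpace.inner_single_right]
    conv_rhs => rw [← sum_smul_single (unitExteriorNormal W y)]
    simp [Finset.smul_sum, smul_comm (radial m ε (y - a))]
  · have := (hφd i).continuousOn.mono hfV
    exact integrableOn_frontier hW hb hs (by fun_prop)

/-- The Cauchy–Pompeiu formula for operators `ē(v)`, `e(v)` with `ē(v) e(v) = |v|²`. -/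
theorem cauchy_pompeiu [CompleteSpace F] (he : ∀ z v, eb z (e z v) = ‖z‖ ^ 2 • v)
    (hW : IsOpen W) (hb : Bornology.IsBounded W)
    (hs : HasSmoothBoundary W) (hV : IsOpen V) (hWV : closure W ⊆ V) (hg : ContDiffOn ℝ 1 g V)
    (ha : a ∈ W) :
    IntegrableOn (fun y => radial m 0 (y - a) • eb (y - a) (e (unitExteriorNormal W y) (g y)))
      (frontier W) (Measure.euclideanHausdorffMeasure m) ∧
    IntegrableOn (fun y => radial m 0 (y - a) • eb (y - a) (diracOp e g y)) W ∧
    (((m + 1) * volume.real (ball (0 : EuclideanSpace ℝ (Fin (m + 1))) 1)) • g a) =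
      (∫ y in frontier W, radial m 0 (y - a) • eb (y - a) (e (unitExteriorNormal W y) (g y))
        ∂(Measure.euclideanHausdorffMeasure m)) -
      ∫ y in W, radial m 0 (y - a) • eb (y - a) (diracOp e g y) := by
  have hcl := hb.isCompact_closure
  have hWV' : W ⊆ V := subset_closure.trans hWV
  have hfV : frontier W ⊆ V := frontier_subset_closure.trans hWV
  have hgc : ContinuousOn g V := hg.continuousOn
  have hDc := continuousOn_diracOp e hV hg
  have hn := continuousOn_unitExteriorNormal hW hs
  have hF := isClosed_frontier (s := W)
  obtain ⟨C₁, hC₁⟩ := hcl.exists_bound_of_continuousOn (hDc.mono hWV)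
  obtain ⟨C₂, hC₂⟩ := (hcl.of_isClosed_subset hF frontier_subset_closure).exists_bound_of_continuousOn
    (f := fun y => e (unitExteriorNormal W y) (g y)) (by have := hgc.mono hfV; fun_prop)
  have hmr : ∀ ε, Measurable fun y => radial m ε (y - a) := fun ε =>
    (measurable_radial ε).comp (measurable_id.sub_const a)
  have hmeas : ∀ (ε : ℝ) {f : EuclideanSpace ℝ (Fin (m + 1)) → F}
      {A : Set (EuclideanSpace ℝ (Fin (m + 1)))} {μ : Measure (EuclideanSpace ℝ (Fin (m + 1)))},
      MeasurableSet A → ContinuousOn f A →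
      AEStronglyMeasurable (fun y => radial m ε (y - a) • eb (y - a) (f y)) (μ.restrict A) :=
    fun ε f A μ hA hf => (hmr ε).aestronglyMeasurable.smul
      (ContinuousOn.aestronglyMeasurable (by fun_prop) hA)
  have hbound : ∀ (ε : ℝ) (z : EuclideanSpace ℝ (Fin (m + 1))) (v : F) (C : ℝ), ‖v‖ ≤ C →
      ‖radial m ε z • eb z v‖ ≤ ‖eb‖ * C * (radial m 0 z * ‖z‖) := fun ε z v C hv => by
    rw [norm_smul, Real.norm_of_nonneg (radial_nonneg _ _)]
    calc radial m ε z * ‖eb z v‖ ≤ radial m ε z * (‖eb‖ * ‖z‖ * C) := by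
          have := radial_nonneg ε z
          gcongr
          exact (eb.le_opNorm₂ z v).trans (by gcongr)
      _ = ‖eb‖ * C * (radial m ε z * ‖z‖) := by ring
      _ ≤ _ := by
          have : 0 ≤ C := (norm_nonneg v).trans hv
          exact mul_le_mul_of_nonneg_left (radial_mul_norm_le ε z) (by positivity)
  have hlim : Tendsto (fun c : ℝ => c⁻¹) atTop (𝓝 0) := tendsto_inv_atTop_zero
  have hptw : ∀ y v, y ≠ a → Tendsto (fun c : ℝ => radial m c⁻¹ (y - a) • eb (y - a) v) atTop
      (𝓝 (radial m 0 (y - a) • eb (y - a) v)) := fun y v hy =>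
    ((tendsto_radial (sub_ne_zero.2 hy)).comp hlim).smul_const _
  have hvolbd : IntegrableOn (fun y => ‖eb‖ * C₁ * (radial m 0 (y - a) * ‖y - a‖)) W :=
    (integrableOn_radial_mul_norm hb a).const_mul _
  have hWm := hW.measurableSet
  have hT1 : Tendsto (fun c : ℝ => ∫ y in W, radial m c⁻¹ (y - a) • eb (y - a) (diracOp e g y))
      atTop (𝓝 (∫ y in W, radial m 0 (y - a) • eb (y - a) (diracOp e g y))) := by
    refine tendsto_integral_filter_of_dominated_convergence _
      (Eventually.of_forall fun c => hmeas _ hWm (hDc.mono hWV'))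
      (Eventually.of_forall fun c => (ae_restrict_iff' hWm).2 (ae_of_all _ fun y hy =>
        hbound _ _ _ _ (hC₁ y (subset_closure hy)))) hvolbd ?_
    refine ae_restrict_of_ae ?_
    filter_upwards [compl_mem_ae_iff.2 (measure_singleton a)] with y hy using hptw y _ hy
  have hane : ∀ y ∈ frontier W, y ≠ a := fun y hy h => by
    rw [hW.frontier_eq] at hy
    exact hy.2 (h ▸ ha)
  have hsurfc : ContinuousOn (fun y => ‖eb‖ * C₂ * (radial m 0 (y - a) * ‖y - a‖)) (frontier W) := by
    have h0 : ∀ y ∈ frontier W, ‖y - a‖ ^ (m + 1) ≠ 0 := fun y hy =>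
      pow_ne_zero _ (norm_ne_zero_iff.2 (sub_ne_zero.2 (hane y hy)))
    simp only [radial_zero]
    fun_prop (disch := assumption)
  have hsurfbd := integrableOn_frontier hW hb hs hsurfc
  have hnc : ContinuousOn (fun y => e (unitExteriorNormal W y) (g y)) (frontier W) := by
    have := hgc.mono hfV
    fun_prop
  have hT3 : Tendsto (fun c : ℝ => ∫ y in frontier W,
        radial m c⁻¹ (y - a) • eb (y - a) (e (unitExteriorNormal W y) (g y))
        ∂(Measure.euclideanHausdorffMeasure m)) atTop
      (𝓝 (∫ y in frontier W, radial m 0 (y - a) • eb (y - a) (e (unitExteriorNormal W y) (g y))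
        ∂(Measure.euclideanHausdorffMeasure m))) :=
    tendsto_integral_filter_of_dominated_convergence _
      (Eventually.of_forall fun c => hmeas _ hF.measurableSet hnc)
      (Eventually.of_forall fun c => (ae_restrict_iff' hF.measurableSet).2 (ae_of_all _ fun y hy =>
        hbound _ _ _ _ (hC₂ y hy))) hsurfbd
      ((ae_restrict_iff' hF.measurableSet).2 (ae_of_all _ fun y hy => hptw y _ (hane y hy)))
  have hT2 := tendsto_setIntegral_peak hW
    (((hgc.mono hWV).integrableOn_compact hcl).mono_set subset_closure) ha
    (hgc.continuousAt (hV.mem_nhds (hWV' ha)))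
  refine ⟨hsurfbd.mono' (hmeas _ hF.measurableSet hnc) ((ae_restrict_iff' hF.measurableSet).2
    (ae_of_all _ fun y hy => hbound _ _ _ _ (hC₂ y hy))), hvolbd.mono' (hmeas _ hWm (hDc.mono hWV'))
    ((ae_restrict_iff' hWm).2 (ae_of_all _ fun y hy => hbound _ _ _ _ (hC₁ y (subset_closure hy)))),
    ?_⟩
  rw [eq_sub_iff_add_eq']
  refine tendsto_nhds_unique (hT1.add hT2) (hT3.congr' ?_)
  filter_upwards [eventually_gt_atTop 0] with c hc
  exact (regularized_cauchy_pompeiu he hW hb hs hV hWV hg a (inv_ne_zero hc.ne')).symm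

end CauchyPompeiu

/-! ### Octonions and slices -/

section Octonions

theorem oct_mul_formula (x y : Oct) : x * y = WithLp.toLp 2 ![
    x 0 * y 0 - x 1 * y 1 - x 2 * y 2 - x 3 * y 3 - x 4 * y 4 - x 5 * y 5 - x 6 * y 6 - x 7 * y 7,
    x 0 * y 1 + x 1 * y 0 + x 2 * y 3 - x 3 * y 2 + x 4 * y 5 - x 5 * y 4 - x 6 * y 7 + x 7 * y 6,
    x 0 * y 2 + x 2 * y 0 - x 1 * y 3 + x 3 * y 1 + x 4 * y 6 - x 6 * y 4 + x 5 * y 7 - x 7 * y 5,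
    x 0 * y 3 + x 3 * y 0 + x 1 * y 2 - x 2 * y 1 + x 4 * y 7 - x 7 * y 4 - x 5 * y 6 + x 6 * y 5,
    x 0 * y 4 + x 4 * y 0 - x 1 * y 5 + x 5 * y 1 - x 2 * y 6 + x 6 * y 2 - x 3 * y 7 + x 7 * y 3,
    x 0 * y 5 + x 5 * y 0 + x 1 * y 4 - x 4 * y 1 - x 2 * y 7 + x 7 * y 2 + x 3 * y 6 - x 6 * y 3,
    x 0 * y 6 + x 6 * y 0 + x 2 * y 4 - x 4 * y 2 + x 1 * y 7 - x 7 * y 1 - x 3 * y 5 + x 5 * y 3,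
    x 0 * y 7 + x 7 * y 0 + x 3 * y 4 - x 4 * y 3 - x 1 * y 6 + x 6 * y 1 + x 2 * y 5 - x 5 * y 2] := by
  ext k
  rw [oct_mul_apply]
  fin_cases k <;>
    simp [Fin.sum_univ_eight, octCoeff, octEps, octTriples] <;> ring

/-- The consequence of left alternativity that replaces associativity in the Cauchy–Pompeiu
formula. -/
theorem octConj_mul_mul_self (a v : Oct) : octConj a * (a * v) = ‖a‖ ^ 2 • v := by
  rw [EuclideanSpace.norm_sq_eq, Fin.sum_univ_eight]
  simp only [Real.norm_eq_abs, sq_abs]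
  rw [oct_mul_formula (octConj a), oct_mul_formula a]
  ext k
  fin_cases k <;> simp [octConj] <;> ring

/-- Octonion multiplication as a continuous bilinear map. -/
noncomputable def octMulL : Oct →L[ℝ] Oct →L[ℝ] Oct :=
  LinearMap.toContinuousLinearMap
    { toFun := fun a => LinearMap.toContinuousLinearMap (leftMul a)
      map_add' := fun a b => by
        ext v k
        simp [leftMul, oct_mul_apply, add_mul, mul_add, Finset.sum_add_distrib]
      map_smul' := fun c a => by
        ext v k
        simp only [leftMul, RingHom.id_apply, LinearMap.coe_toContinuousLinearMap', LinearMap.coe_mk,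
          AddHom.coe_mk, oct_mul_apply, PiLp.smul_apply, smul_eq_mul,
          _root_.smul_apply, Finset.mul_sum]
        exact Finset.sum_congr rfl fun i _ => Finset.sum_congr rfl fun j _ => by ring }

@[simp]
theorem octMulL_apply (a v : Oct) : octMulL a v = a * v := rfl

theorem leftMul_apply (a v : Oct) : leftMul a v = a * v := rfl

/-- Octonion conjugation as a continuous linear map. -/
noncomputable def octConjL : Oct →L[ℝ] Oct :=
  LinearMap.toContinuousLinearMap
    { toFun := octConj
      map_add' := fun a b => by
        ext k
        simp only [octConj, PiLp.add_apply]
        split_ifs <;> ring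
      map_smul' := fun c a => by
        ext k
        simp only [octConj, PiLp.smul_apply, smul_eq_mul, RingHom.id_apply]
        split_ifs <;> ring }

@[simp]
theorem octConjL_apply (a : Oct) : octConjL a = octConj a := rfl

variable {p : ℕ}

theorem neg_mem_imSphere {w : Oct} (hw : w ∈ imSphere p) : -w ∈ imSphere p :=
  ⟨fun i hi => by simp [hw.1 i hi], by rw [norm_neg, hw.2]⟩

theorem imSphere_mul_mul {w : Oct} (hw : w ∈ imSphere p) (v : Oct) : w * (w * v) = -v := by
  have hconj : octConj w = -w := by
    ext i
    by_cases hi : i = 0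
    · subst hi; simp [octConj, hw.1 0 (by simp)]
    · simp [octConj, hi]
  have h := octConj_mul_mul_self w v
  rw [hconj, hw.2, one_pow, one_smul, ← octMulL_apply (-w), map_neg,
    _root_.neg_apply] at h
  exact neg_eq_iff_eq_neg.1 h

/-- The vectors `e_0, …, e_p, w` spanning the slice `ℝ^{p+1} ⊕ wℝ`. -/
noncomputable def sliceFrame (p : ℕ) (w : Oct) : Fin (p + 2) → Oct :=
  Fin.snoc (α := fun _ => Oct) (fun i : Fin (p + 1) => octBasis i) w

@[simp]
theorem sliceFrame_castSucc (w : Oct) (i : Fin (p + 1)) :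
    sliceFrame p w i.castSucc = octBasis i := by
  simp [sliceFrame]

@[simp]
theorem sliceFrame_last (w : Oct) : sliceFrame p w (Fin.last (p + 1)) = w := by
  simp [sliceFrame]

theorem sliceEmbed_eq_sum (w : Oct) (x : SliceSpace p) :
    sliceEmbed p w x = ∑ i, x i • sliceFrame p w i := by
  rw [Fin.sum_univ_castSucc]
  simp [sliceEmbed]

theorem octBasis_eq_single {k : ℕ} (hk : k < 8) : octBasis k = EuclideanSpace.single ⟨k, hk⟩ 1 := by
  ext i
  simp [octBasis, Fin.ext_iff]

theorem orthonormal_sliceFrame (hp : p ≤ 6) {w : Oct} (hw : w ∈ imSphere p) :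
    Orthonormal ℝ (sliceFrame p w) := by
  have hlt : ∀ i : Fin (p + 1), (i : ℕ) < 8 := fun i => by omega
  have hbw : ∀ i : Fin (p + 1), w ⟨i, hlt i⟩ = 0 := fun i => hw.1 _ (by simp; omega)
  rw [orthonormal_iff_ite]
  intro i j
  induction i using Fin.lastCases with
  | last =>
    induction j using Fin.lastCases with
    | last => simp [hw.2]
    | cast j =>
      rw [sliceFrame_last, sliceFrame_castSucc, octBasis_eq_single (hlt j)]
      simp [EuclideanSpace.inner_single_right, hbw, (Fin.castSucc_lt_last j).ne']
  | cast i =>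
    induction j using Fin.lastCases with
    | last =>
      rw [sliceFrame_last, sliceFrame_castSucc, octBasis_eq_single (hlt i)]
      simp [EuclideanSpace.inner_single_left, hbw, (Fin.castSucc_lt_last i).ne]
    | cast j =>
      rw [sliceFrame_castSucc, sliceFrame_castSucc, octBasis_eq_single (hlt i),
        octBasis_eq_single (hlt j)]
      simp [EuclideanSpace.inner_single_left, Fin.ext_iff]

theorem norm_sliceEmbed (hp : p ≤ 6) {w : Oct} (hw : w ∈ imSphere p) (x : SliceSpace p) :
    ‖sliceEmbed p w x‖ = ‖x‖ := by
  have h := (orthonormal_sliceFrame hp hw).inner_sum x x Finset.univ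
  rw [← sliceEmbed_eq_sum, real_inner_self_eq_norm_sq] at h
  rw [← sq_eq_sq₀ (norm_nonneg _) (norm_nonneg _), h, EuclideanSpace.norm_sq_eq]
  exact Finset.sum_congr rfl fun i _ => by simp [sq]

/-- The identification of `ℝ^{p+2}` with a slice, as a continuous linear map. -/
noncomputable def sliceEmbedL (p : ℕ) (w : Oct) : SliceSpace p →L[ℝ] Oct :=
  LinearMap.toContinuousLinearMap
    { toFun := sliceEmbed p w
      map_add' := fun x y => by
        simp [sliceEmbed_eq_sum, add_smul, Finset.sum_add_distrib]
      map_smul' := fun c x => by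
        simp [sliceEmbed_eq_sum, smul_smul, Finset.smul_sum] }

@[simp]
theorem sliceEmbedL_apply (w : Oct) (x : SliceSpace p) : sliceEmbedL p w x = sliceEmbed p w x := rfl

theorem sliceEmbed_single (w : Oct) (i : Fin (p + 2)) :
    sliceEmbed p w (EuclideanSpace.single i 1) = sliceFrame p w i := by
  rw [sliceEmbed_eq_sum]
  simp

/-- Left multiplication by the points of a slice. -/
noncomputable def sliceMul (p : ℕ) (w : Oct) : SliceSpace p →L[ℝ] Oct →L[ℝ] Oct :=
  octMulL ∘L sliceEmbedL p w

/-- Left multiplication by the conjugates of the points of a slice. -/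
noncomputable def sliceConjMul (p : ℕ) (w : Oct) : SliceSpace p →L[ℝ] Oct →L[ℝ] Oct :=
  octMulL ∘L octConjL ∘L sliceEmbedL p w

theorem sliceConjMul_sliceMul (hp : p ≤ 6) {w : Oct} (hw : w ∈ imSphere p) (z : SliceSpace p)
    (v : Oct) : sliceConjMul p w z (sliceMul p w z v) = ‖z‖ ^ 2 • v := by
  simpa [sliceConjMul, sliceMul, norm_sliceEmbed hp hw] using
    octConj_mul_mul_self (sliceEmbed p w z) v

theorem sliceD_eq_diracOp (η : Oct) (f : Oct → Oct) (y : SliceSpace p) :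
    sliceD p η f y = diracOp (sliceMul p η) (fun z => f (sliceEmbed p η z)) y := by
  refine Eq.trans ?_ (Fin.sum_univ_castSucc _).symm
  simp [sliceD, sliceMul, sliceEmbed_single]

theorem cauchyEAt_mul (hp : p ≤ 6) {η : Oct} (hη : η ∈ imSphere p) (y a : SliceSpace p) (v : Oct) :
    cauchyEAt p (sliceEmbed p η y) (sliceEmbed p η a) * v =
      (sphereArea p)⁻¹ • (radial (p + 1) 0 (y - a) • sliceConjMul p η (y - a) v) := by
  have hsub : sliceEmbed p η y - sliceEmbed p η a = sliceEmbed p η (y - a) :=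
    ((sliceEmbedL p η).map_sub y a).symm
  rw [cauchyEAt, hsub, cauchyE, norm_sliceEmbed hp hη, radial_zero, ← octMulL_apply, map_smul,
    smul_smul, one_div, mul_inv]
  rfl

theorem sphereArea_eq (p : ℕ) : sphereArea p =
    ((p + 1 : ℕ) + 1 : ℝ) * volume.real (ball (0 : SliceSpace p) 1) := by
  rw [Measure.real, EuclideanSpace.volume_ball, Fintype.card_fin, ENNReal.ofReal_one, one_pow,
    one_mul, ENNReal.toReal_ofReal (by positivity), sphereArea, Real.Gamma_one_half_eq]
  push_cast
  rw [Real.Gamma_add_one (by positivity)]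
  have : Real.Gamma (((p : ℝ) + 2) / 2) ≠ 0 := (Real.Gamma_pos_of_pos (by positivity)).ne'
  field_simp
  ring

theorem sphereArea_pos (p : ℕ) : 0 < sphereArea p := by
  have h1 : 0 < Real.Gamma (((p : ℝ) + 2) / 2) := Real.Gamma_pos_of_pos (by positivity)
  have h2 : 0 < Real.Gamma (1 / 2) := Real.Gamma_pos_of_pos (by norm_num)
  unfold sphereArea
  positivity

/-- The Cauchy–Pompeiu formula on a slice of the octonions. -/
theorem slice_cauchy_pompeiu (hp : p ≤ 6) {η : Oct} (hη : η ∈ imSphere p)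
    {W D : Set (SliceSpace p)} (hW : IsOpen W) (hb : Bornology.IsBounded W)
    (hs : HasSmoothBoundary W) (hD : IsOpen D) (hWD : closure W ⊆ D) {f : Oct → Oct}
    (hf : ContDiffOn ℝ 1 (fun z => f (sliceEmbed p η z)) D) {a : SliceSpace p} (ha : a ∈ W) :
    Integrable (fun y => cauchyEAt p (sliceEmbed p η y) (sliceEmbed p η a) *
      (sliceEmbed p η (unitExteriorNormal W y) * f (sliceEmbed p η y))) (surfaceMeasure p W) ∧
    IntegrableOn (fun y => cauchyEAt p (sliceEmbed p η y) (sliceEmbed p η a) * sliceD p η f y) W ∧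
    f (sliceEmbed p η a) =
      (∫ y, cauchyEAt p (sliceEmbed p η y) (sliceEmbed p η a) *
        (sliceEmbed p η (unitExteriorNormal W y) * f (sliceEmbed p η y)) ∂(surfaceMeasure p W)) -
      ∫ y in W, cauchyEAt p (sliceEmbed p η y) (sliceEmbed p η a) * sliceD p η f y := by
  obtain ⟨h1, h2, h3⟩ := cauchy_pompeiu (sliceConjMul_sliceMul hp hη) hW hb hs hD hWD hf ha
  simp only [cauchyEAt_mul hp hη, sliceD_eq_diracOp]
  refine ⟨h1.smul (sphereArea p)⁻¹, h2.smul (sphereArea p)⁻¹, ?_⟩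
  rw [integral_smul, integral_smul, ← smul_sub, eq_inv_smul_iff₀ (sphereArea_pos p).ne',
    sphereArea_eq]
  exact h3

end Octonions

/-! ### Generalized partial-slice functions -/

section PartialSliceFunctions

variable {p : ℕ}

theorem sliceEmbed_reflect (w : Oct) (x : SliceSpace p) :
    sliceEmbed p w (reflect p x) = sliceEmbed p (-w) x := by
  simp [sliceEmbed, reflect, (Fin.castSucc_lt_last _).ne]

theorem reflect_reflect (x : SliceSpace p) : reflect p (reflect p x) = x := by
  ext i
  by_cases hi : i = Fin.last (p + 1) <;> simp [reflect, hi]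

theorem reflect_last (x : SliceSpace p) :
    reflect p x (Fin.last (p + 1)) = -x (Fin.last (p + 1)) := by
  simp [reflect]

/-- The coordinate `x_i`, `i ≤ p`, is the coefficient of `e_i`. -/
theorem sliceEmbed_apply (hp : p ≤ 6) {w : Oct} (hw : w ∈ imSphere p) (x : SliceSpace p)
    (i : Fin (p + 1)) : sliceEmbed p w x ⟨i, by omega⟩ = x i.castSucc := by
  have h0 : w ⟨i, by omega⟩ = 0 := hw.1 _ (by simp; omega)
  simp [sliceEmbed, octBasis, h0, Fin.val_inj]

/-- A point with two representations `x_p + rη = x'_p + r'w` has `x'_p = x_p` and `r' = ±r`; hence the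
slice of `Ω_D` stays in the symmetric set `D`. -/
theorem slice_symCompletion_subset (hp : p ≤ 6) {D : Set (SliceSpace p)}
    (hD : ∀ x ∈ D, reflect p x ∈ D) {η : Oct} (hη : η ∈ imSphere p) :
    slice p η (symCompletion p D) ⊆ D := by
  rintro x ⟨w, hw, x', hx', -, he⟩
  have hcoord : ∀ i : Fin (p + 1), x i.castSucc = x' i.castSucc := fun i => by
    rw [← sliceEmbed_apply hp hη x i, he, sliceEmbed_apply hp hw x' i]
  have hlast : x (Fin.last (p + 1)) ^ 2 = x' (Fin.last (p + 1)) ^ 2 := by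
    have hn : ‖x‖ ^ 2 = ‖x'‖ ^ 2 := by
      rw [← norm_sliceEmbed hp hη x, he, norm_sliceEmbed hp hw x']
    rw [EuclideanSpace.norm_sq_eq, EuclideanSpace.norm_sq_eq, Fin.sum_univ_castSucc,
      Fin.sum_univ_castSucc (fun i => ‖x' i‖ ^ 2)] at hn
    simpa [hcoord] using hn
  rcases sq_eq_sq_iff_eq_or_eq_neg.1 hlast with h | h
  · have : x = x' := by
      ext i
      induction i using Fin.lastCases with
      | last => exact h
      | cast i => exact hcoord i
    exact this ▸ hx'
  · have : x = reflect p x' := by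
      ext i
      induction i using Fin.lastCases with
      | last => rw [reflect_last, h]
      | cast i => simp [reflect, (Fin.castSucc_lt_last _).ne, hcoord]
    exact this ▸ hD _ hx'

/-- The representation `f = F₁ + w F₂` holds on the whole slice, not only where `r ≥ 0`. -/
theorem apply_sliceEmbed {D : Set (SliceSpace p)} (hD : ∀ x ∈ D, reflect p x ∈ D)
    {F₁ F₂ : SliceSpace p → Oct} (hstem : IsStem p D F₁ F₂) {f : Oct → Oct}
    (hf : ∀ w ∈ imSphere p, ∀ x' ∈ D, 0 ≤ x' (Fin.last (p + 1)) →
      f (sliceEmbed p w x') = F₁ x' + w * F₂ x')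
    {w : Oct} (hw : w ∈ imSphere p) {x : SliceSpace p} (hx : x ∈ D) :
    f (sliceEmbed p w x) = F₁ x + w * F₂ x := by
  rcases le_total 0 (x (Fin.last (p + 1))) with h | h
  · exact hf w hw x hx h
  · have h1 := hf (-w) (neg_mem_imSphere hw) (reflect p x) (hD x hx)
      (by rw [reflect_last]; linarith)
    rw [← sliceEmbed_reflect, reflect_reflect, (hstem x hx).1, (hstem x hx).2] at h1
    simpa only [← octMulL_apply, map_neg, _root_.neg_apply, neg_neg] using h1

theorem globalKernel_apply (η w : Oct) (y x : SliceSpace p) (v : Oct) :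
    globalKernel p η w y x v =
      (1 / 2 : ℝ) • ((cauchyEAt p (sliceEmbed p η y) (sliceEmbed p η x) * v) +
        cauchyEAt p (sliceEmbed p η y) (sliceEmbed p η (reflect p x)) * v) +
      (1 / 2 : ℝ) • octMulL w (octMulL η
        (cauchyEAt p (sliceEmbed p η y) (sliceEmbed p η (reflect p x)) * v -
          cauchyEAt p (sliceEmbed p η y) (sliceEmbed p η x) * v)) := by
  simp only [globalKernel, LinearMap.add_apply, LinearMap.smul_apply, LinearMap.comp_apply,
    leftMul_apply, ← octMulL_apply, map_add, map_sub, _root_.add_apply, _root_.sub_apply]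

/-- The values of a partial-slice function on the slice of `w` are recovered from its values on the
slice of `η` by the linear map that defines the global kernel. -/
theorem representation_formula {η w : Oct} (hη : η ∈ imSphere p) (A B : Oct) :
    A + w * B = (1 / 2 : ℝ) • ((A + η * B) + (A + -η * B)) +
      (1 / 2 : ℝ) • octMulL w (octMulL η ((A + -η * B) - (A + η * B))) := by
  have h := imSphere_mul_mul hη B
  simp only [← octMulL_apply] at h ⊢
  simp only [map_sub, map_add, map_neg, _root_.neg_apply, h]
  module

/-- The linear map of the representation formula commutes with integration. -/
theorem integral_representation (η w : Oct) {μ : Measure (SliceSpace p)} {A B : SliceSpace p → Oct}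
    (hA : Integrable A μ) (hB : Integrable B μ) :
    Integrable (fun y => (1 / 2 : ℝ) • (A y + B y) +
      (1 / 2 : ℝ) • octMulL w (octMulL η (B y - A y))) μ ∧
    ∫ y, ((1 / 2 : ℝ) • (A y + B y) + (1 / 2 : ℝ) • octMulL w (octMulL η (B y - A y))) ∂μ =
      (1 / 2 : ℝ) • ((∫ y, A y ∂μ) + ∫ y, B y ∂μ) +
      (1 / 2 : ℝ) • octMulL w (octMulL η ((∫ y, B y ∂μ) - ∫ y, A y ∂μ)) := by
  have k0 : Integrable (fun y => B y - A y) μ := hB.sub hA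
  have k1 : Integrable (fun y => (1 / 2 : ℝ) • (A y + B y)) μ := (hA.add hB).smul (1 / 2 : ℝ)
  have k2 : Integrable (fun y => octMulL η (B y - A y)) μ := (octMulL η).integrable_comp k0
  have k3 : Integrable (fun y => (1 / 2 : ℝ) • octMulL w (octMulL η (B y - A y))) μ :=
    ((octMulL w).integrable_comp k2).smul (1 / 2 : ℝ)
  refine ⟨k1.add k3, ?_⟩
  rw [integral_add k1 k3, integral_smul, integral_smul, integral_add hA hB,
    (octMulL w).integral_comp_comm k2, (octMulL η).integral_comp_comm k0, integral_sub hB hA]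

end PartialSliceFunctions

end PartialSlice

theorem mainTheorem4 (p : ℕ) (hp : p ≤ 6)
    (D : Set (SliceSpace p)) (hD : IsOpen D) (hDrefl : ∀ x' ∈ D, reflect p x' ∈ D)
    (f : Oct → Oct) (hf : IsGS1 p D f)
    (η : Oct) (hη : η ∈ imSphere p)
    (U : Set Oct) (hU : IsOpen U) (hUconn : IsConnected U)
    (hUsub : slice p η U ⊆ slice p η (symCompletion p D))
    (hUbdd : Bornology.IsBounded (slice p η U))
    (hUηopen : IsOpen (slice p η U)) (hUηconn : IsConnected (slice p η U))
    (hUsmooth : HasSmoothBoundary (slice p η U))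
    (hUfront : frontier (slice p η U) ⊆ slice p η (symCompletion p D))
    (w : Oct) (hw : w ∈ imSphere p)
    (x' : SliceSpace p) (hr : 0 ≤ x' (Fin.last (p + 1)))
    (hx : sliceEmbed p η x' ∈ U) (hxrefl : sliceEmbed p η (reflect p x') ∈ U) :
    Integrable (fun y => globalKernel p η w y x'
        (sliceEmbed p η (unitExteriorNormal (slice p η U) y) * f (sliceEmbed p η y)))
      (surfaceMeasure p (slice p η U)) ∧
    IntegrableOn (fun y => globalKernel p η w y x' (sliceD p η f y)) (slice p η U) volume ∧
    f (sliceEmbed p w x') =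
      (∫ y, globalKernel p η w y x'
          (sliceEmbed p η (unitExteriorNormal (slice p η U) y) * f (sliceEmbed p η y))
        ∂(surfaceMeasure p (slice p η U)))
      - ∫ y in slice p η U, globalKernel p η w y x' (sliceD p η f y) := by
  have hDsub := slice_symCompletion_subset hp hDrefl hη
  obtain ⟨F₁, F₂, hstem, hF₁, hF₂, hfF⟩ := hf
  have hrep : ∀ v ∈ imSphere p, ∀ y ∈ D, f (sliceEmbed p v y) = F₁ y + v * F₂ y :=
    fun v hv y hy => apply_sliceEmbed hDrefl hstem hfF hv hy
  have hsmooth : ContDiffOn ℝ 1 (fun z => f (sliceEmbed p η z)) D :=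
    (hF₁.add ((octMulL η).contDiff.comp_contDiffOn hF₂)).congr fun z hz => hrep η hη z hz
  have hclosure : closure (slice p η U) ⊆ D := by
    rw [closure_eq_self_union_frontier]
    exact union_subset (hUsub.trans hDsub) (hUfront.trans hDsub)
  have hx'D : x' ∈ D := hDsub (hUsub hx)
  obtain ⟨i1, j1, e1⟩ := slice_cauchy_pompeiu hp hη hUηopen hUbdd hUsmooth hD hclosure hsmooth
    (a := x') hx
  obtain ⟨i2, j2, e2⟩ := slice_cauchy_pompeiu hp hη hUηopen hUbdd hUsmooth hD hclosure hsmooth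
    (a := reflect p x') hxrefl
  have hval : f (sliceEmbed p w x') = (1 / 2 : ℝ) • (f (sliceEmbed p η x') +
      f (sliceEmbed p η (reflect p x'))) + (1 / 2 : ℝ) • octMulL w (octMulL η
        (f (sliceEmbed p η (reflect p x')) - f (sliceEmbed p η x'))) := by
    rw [sliceEmbed_reflect, hrep w hw x' hx'D, hrep η hη x' hx'D,
      hrep (-η) (neg_mem_imSphere hη) x' hx'D]
    exact representation_formula hη _ _
  simp only [globalKernel_apply]
  refine ⟨(integral_representation η w i1 i2).1, (integral_representation η w j1 j2).1, ?_⟩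
  rw [(integral_representation η w i1 i2).2, (integral_representation η w j1 j2).2, hval, e1, e2]
  simp only [map_sub]
  module
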